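/- Let $\mathbb D$ be the open unit disc of $\mathbb C$, $\mathcal H(\mathbb D)$ the space of analytic functions on $\mathbb D$, and $dA=\frac{dx\,dy}{\pi}$. Let $\omega=e^{-2\varphi}$ be a smooth rapidly decreasing weight, that is, $\varphi:\mathbb D\to(0,\infty)$ is a radial $C^2$ function which is increasing and convex on $[0,1)$ and satisfies $\Delta\varphi>0$ on $\mathbb D$, and there is a positive decreasing $C^1$ function $\tau$ on $[0,1)$ such that: (i) $(\Delta\varphi(z))^{-1/2}\simeq\tau(|z|)$ for $z\in\mathbb D$, and $\lim_{r\to1^-}\tau(r)=\lim_{r\to1^-}\tau'(r)=0$; (ii) either there is a constant $c>0$ such that $\tau(r)(1-r)^{-c}$ increases for $r$ close to $1$, or $\lim_{r\to1^-}\tau'(r)\log\frac1{\tau(r)}=0$; (iii) for some $\eta>0$ the function $h=(1+\varphi')\tau^{\eta}$ is essentially decreasing on $[0,1)$, i.e. there is a constant $K>0$ with $h(s)\le K\,h(t)$ whenever $0\le t\le s<1$. For $0<p<\infty$ put $\omega_p=\omega^{p/2}$ and, for $f\in\mathcal H(\mathbb D)$, $\|f\|_{A^p_{\omega_p}}=\left(\int_{\mathbb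 D}|f|^p\omega_p\,dA\right)^{1/p}\in[0,\infty]$. For a linear map $L:\mathcal H(\mathbb D)\to\mathcal H(\mathbb D)$ let $\|L\|_{A^p_{\omega_p}}=\sup\{\|Lf\|_{A^p_{\omega_p}}: f\in\mathcal H(\mathbb D),\ \|f\|_{A^p_{\omega_p}}=1\}\in[0,\infty]$. For $g\in\mathcal H(\mathbb D)$ let $$T_gf(z)=\int_0^z f(\zeta)g'(\zeta)\,d\zeta,\qquad S_gf(z)=\int_0^z f'(\zeta)g(\zeta)\,d\zeta .$$ For a real $q\ge1$ define $\|g\|_{\mathscr B^q_\varphi}\in[0,\infty]$ by $$\|g\|_{\mathscr B^q_\varphi}^q=\sup_{z\in\mathbb D}\frac{|\nabla|g|^q|(z)}{1+\varphi'(|z|)},\qquad\text{where}\quad |\nabla\psi|(z)=\limsup_{w\to z}\frac{|\psi(w)-\psi(z)|}{|w-z|}.$$ **Theorem.** Let $\omega=e^{-2\varphi}$ be a smooth rapidly decreasing weight, $0<p<\infty$, $m\in\mathbb N_0$, $n\in\mathbb N$ with $n\ge1$, and $s=\frac mn+1$. Then there is a constant $C\in(0,\infty)$, depending only on $\omega$,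 $p$, $m$ and $n$, such that $$\|S_g^mT_g^n\|_{A^p_{\omega_p}}\le C\,\|g\|_{\mathscr B^s_\varphi}^{sn}\qquad\text{for every } g\in\mathcal H(\mathbb D).$$ -/

import Mathlib

open MeasureTheory Filter Topology Set
open scoped ENNReal NNReal

noncomputable section

namespace SWBergman

/-- The open unit disc of the complex plane. -/
def disc : Set ℂ := Metric.ball 0 1

/-- `φ'(r)`, where a radial function `φ` on the disc is regarded as the function `r ↦ φ(r)`
of a real variable. -/
def radialDeriv (φ : ℂ → ℝ) (r : ℝ) : ℝ := deriv (fun t : ℝ => φ (t : ℂ)) r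

/-- `h` is essentially decreasing on `[0,1)`. -/
def EssentiallyDecreasing (h : ℝ → ℝ) : Prop :=
  ∃ K : ℝ, 0 < K ∧ ∀ t s : ℝ, 0 ≤ t → t ≤ s → s < 1 → h s ≤ K * h t

/-- The conditions on the auxiliary function `τ` which concern only `τ` itself. -/
structure IsAdmissibleScale (τ : ℝ → ℝ) : Prop where
  pos : ∀ r ∈ Ico (0 : ℝ) 1, 0 < τ r
  decreasing : AntitoneOn τ (Ico 0 1)
  contDiff : ContDiffOn ℝ 1 τ (Ico 0 1)
  tendsto_zero : Tendsto τ (𝓝[<] 1) (𝓝 0)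
  tendsto_deriv_zero : Tendsto (deriv τ) (𝓝[<] 1) (𝓝 0)
  growth :
    (∃ C : ℝ, 0 < C ∧ ∃ r₀ ∈ Ico (0 : ℝ) 1,
      MonotoneOn (fun r => τ r * (1 - r) ^ (-C)) (Ico r₀ 1)) ∨
    Tendsto (fun r => deriv τ r * Real.log (1 / τ r)) (𝓝[<] 1) (𝓝 0)

/-- `e^{-2φ}` is a smooth rapidly decreasing weight on the unit disc. -/
structure IsSmoothRapidlyDecreasing (φ : ℂ → ℝ) : Prop where
  radial : ∀ z ∈ disc, ∀ w ∈ disc, ‖z‖ = ‖w‖ → φ z = φ w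
  pos : ∀ z ∈ disc, 0 < φ z
  contDiff : ContDiffOn ℝ 2 φ disc
  increasing : MonotoneOn (fun r : ℝ => φ (r : ℂ)) (Ico 0 1)
  laplacian_pos : ∀ z ∈ disc, 0 < Laplacian.laplacian φ z
  convex : ConvexOn ℝ (Ico 0 1) (fun r : ℝ => φ (r : ℂ))
  exists_scale : ∃ τ : ℝ → ℝ, IsAdmissibleScale τ ∧
    (∃ c C : ℝ, 0 < c ∧ 0 < C ∧ ∀ z ∈ disc,
      c * τ ‖z‖ ≤ (Laplacian.laplacian φ z) ^ (-(1 / 2) : ℝ) ∧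
      (Laplacian.laplacian φ z) ^ (-(1 / 2) : ℝ) ≤ C * τ ‖z‖) ∧
    ∃ η : ℝ, 0 < η ∧ EssentiallyDecreasing (fun r => (1 + radialDeriv φ r) * τ r ^ η)

/-- The weight `ω = e^{-2φ}`. -/
def weight (φ : ℂ → ℝ) (z : ℂ) : ℝ := Real.exp (-2 * φ z)

/-- The normalized area measure `dA = dx dy / π` on the unit disc. -/
def areaMeasure : Measure ℂ := (ENNReal.ofReal Real.pi)⁻¹ • volume.restrict disc

/-- The (quasi-)norm `‖f‖ = (∫_𝔻 |f|^p ω dA)^{1/p} ∈ [0,∞]` of the weighted Bergman space. -/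
def bergmanNorm (p : ℝ) (ω : ℂ → ℝ) (f : ℂ → ℂ) : ℝ≥0∞ :=
  (∫⁻ z, ENNReal.ofReal (‖f z‖ ^ p * ω z) ∂areaMeasure) ^ (1 / p)

/-- `f` is analytic on the unit disc. Values outside the disc are irrelevant throughout. -/
def AnalyticOnDisc (f : ℂ → ℂ) : Prop := DifferentiableOn ℂ f disc

/-- The operator norm `sup {‖L f‖ : ‖f‖ = 1} ∈ [0,∞]` of `L` on the weighted Bergman space,
the supremum being over functions `f` analytic on the disc. -/
def opNorm (p : ℝ) (ω : ℂ → ℝ) (L : (ℂ → ℂ) → (ℂ → ℂ)) : ℝ≥0∞ :=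
  ⨆ (f : ℂ → ℂ) (_ : AnalyticOnDisc f) (_ : bergmanNorm p ω f = 1), bergmanNorm p ω (L f)

/-- The integral `∫_0^z h(ζ) dζ` along the segment from `0` to `z`. -/
def integralFromZero (h : ℂ → ℂ) (z : ℂ) : ℂ := ∫ t in (0 : ℝ)..1, h (t * z) * z

/-- `T_g f (z) = ∫_0^z f(ζ) g'(ζ) dζ`. -/
def T (g f : ℂ → ℂ) : ℂ → ℂ := integralFromZero fun ζ => f ζ * deriv g ζ

/-- `S_g f (z) = ∫_0^z f'(ζ) g(ζ) dζ`. -/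
def S (g f : ℂ → ℂ) : ℂ → ℂ := integralFromZero fun ζ => deriv f ζ * g ζ

/-- `|∇ψ|(z) = limsup_{w → z} |ψ(w) - ψ(z)| / |w - z| ∈ [0,∞]`. -/
def gradNorm (ψ : ℂ → ℝ) (z : ℂ) : ℝ≥0∞ :=
  limsup (fun w => ENNReal.ofReal (|ψ w - ψ z| / ‖w - z‖)) (𝓝[≠] z)

/-- The Bloch-type quantity `‖g‖`, with `‖g‖^q = sup_{z ∈ 𝔻} |∇|g|^q|(z) / (1 + φ'(|z|))`. -/
def blochNorm (φ : ℂ → ℝ) (q : ℝ) (g : ℂ → ℂ) : ℝ≥0∞ :=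
  (⨆ z ∈ disc, gradNorm (fun w => ‖g w‖ ^ q) z /
    ENNReal.ofReal (1 + radialDeriv φ ‖z‖)) ^ (1 / q)

end SWBergman

end

/-!
For `F` with `F(0) = 0` the weight `e^{-pφ}` allows a Littlewood–Paley inequality `∫ |F|^p e^{-pφ}
≲ ∫ (|F'| / (1 + φ'))^p e^{-pφ}`. Since `(S_g^m T_g^n f)' = g^m g' T_g^{n-1} f`, it would suffice
to estimate `|g|^{αk} T_g^k f` for `k = 0, …, n - 1`, where `α = m / n`, using `|g|^α |g'| ≲ B (1
+ φ')` with `s = α + 1` and `B` any number above `sup |∇|g|^s| / (1 + φ')`. As `|g|^{αk} T_g^k f`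
is not analytic, the factor `|g|^{αk}` is made part of the weight, after `|g|^s` has been replaced
by `Γ = |g|^s + Λ B`. The condition on `|∇|g|^s|` says that `|g|^s` varies by `O(B)` at the scale
`1 / (1 + φ')`; hence `Γ` is nearly constant there when `Λ` is large, whereas `e^{-pφ}` decreases
by a fixed factor over such a radial step. So the weights `Γ^a e^{-pφ}` obey the Littlewood–Paley
inequality too, with constants independent of `g`, and `n` applications of it give the theorem.
For `Γ` the bound `Γ^{α/s} |g'| ≲ B (1 + φ')` holds everywhere: where `|g|^s ≥ B` by the Bloch
condition, elsewhere by Cauchy's estimate.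

The Littlewood–Paley inequality (`RadialScale.littlewoodPaley`) is proved for all `0 < p < ∞` at
once by comparing `|F(z)|^p` with its value at the point `z` shifted radially inwards by half of
`c / (1 + φ')`. Since `φ'` is increasing this shift expands radial distances, so the decay of the
weight lets the shifted integral be absorbed. The difference is at most the step times the supremum of `|F'|`
on the segment, and this supremum is dominated by an area average because `|F'|^p` has the
sub-mean value property.

The scale `1 / (1 + φ')` is admissible because `(r φ')' = r Δφ ≃ r τ⁻²` and `τ' → 0` force `1 + φ'
≳ 1 / τ`; the essential monotonicity of `(1 + φ') τ^η` then makes `1 + φ'` doubling at that scale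
(`IsSmoothRapidlyDecreasing.exists_radialScale`).
-/

namespace SWBergman

/-! ### Integration in polar coordinates and the sub-mean value property -/

lemma lintegral_polar {F : ℂ → ℝ≥0∞} (hF : Measurable F) :
    ∫⁻ z, F z = ∫⁻ θ in Ioo (-Real.pi) Real.pi, ∫⁻ r in Ioi (0 : ℝ),
      ENNReal.ofReal r * F (circleMap 0 r θ) := by
  rw [← Complex.lintegral_comp_polarCoord_symm, polarCoord_target, Measure.volume_eq_prod,
    setLIntegral_prod_symm]
  · refine lintegral_congr fun θ => lintegral_congr fun r => ?_
    rw [Complex.polarCoord_symm_apply, circleMap, Complex.exp_mul_I]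
    simp
  · apply Measurable.aemeasurable
    simp only [Complex.polarCoord_symm_apply, smul_eq_mul]
    fun_prop

lemma lintegral_polar' {F : ℂ → ℝ≥0∞} (hF : Measurable F) :
    ∫⁻ z, F z = ∫⁻ r in Ioi (0 : ℝ), ENNReal.ofReal r *
      ∫⁻ θ in Ioo (-Real.pi) Real.pi, F (circleMap 0 r θ) := by
  rw [← Complex.lintegral_comp_polarCoord_symm, polarCoord_target, Measure.volume_eq_prod,
    setLIntegral_prod]
  · refine lintegral_congr fun r => ?_
    rw [← lintegral_const_mul _ (by fun_prop)]
    refine lintegral_congr fun θ => ?_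
    rw [Complex.polarCoord_symm_apply, circleMap, Complex.exp_mul_I]
    simp
  · apply Measurable.aemeasurable
    simp only [Complex.polarCoord_symm_apply, smul_eq_mul]
    fun_prop

lemma two_pi_mul_enorm_le_lintegral_circle {f : ℂ → ℂ} {z : ℂ} {t : ℝ} (ht : 0 < t)
    (hf : DiffContOnCl ℂ f (Metric.ball z t)) :
    ENNReal.ofReal (2 * Real.pi) * ‖f z‖ₑ ≤
      ∫⁻ θ in Ioo (-Real.pi) Real.pi, ‖f (circleMap z t θ)‖ₑ := by
  have h1 : Real.circleAverage f z t = f z := by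
    apply DiffContOnCl.circleAverage
    rwa [abs_of_pos ht]
  have hper : Function.Periodic (fun θ : ℝ => f (circleMap z t θ)) (2 * Real.pi) := fun θ => by
    simp only [periodic_circleMap z t θ]
  have h2 : ∫ θ in (0 : ℝ)..2 * Real.pi, f (circleMap z t θ)
      = ∫ θ in Ioc (-Real.pi) Real.pi, f (circleMap z t θ) := by
    have := hper.intervalIntegral_add_eq 0 (-Real.pi)
    rw [zero_add, show -Real.pi + 2 * Real.pi = Real.pi by ring] at this
    rw [this, intervalIntegral.integral_of_le (by linarith [Real.pi_pos])]
  rw [Real.circleAverage, h2, integral_Ioc_eq_integral_Ioo] at h1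
  have h3 : ((2 * Real.pi : ℝ)) • f z =
      ∫ θ in Ioo (-Real.pi) Real.pi, f (circleMap z t θ) := by
    rw [← h1, smul_smul, mul_inv_cancel₀ (by positivity), one_smul]
  calc ENNReal.ofReal (2 * Real.pi) * ‖f z‖ₑ = ‖((2 * Real.pi : ℝ)) • f z‖ₑ := by
        rw [enorm_smul, Real.enorm_eq_ofReal (by positivity)]
    _ ≤ _ := by rw [h3]; exact enorm_integral_le_lintegral_enorm _

lemma measurable_indicator_of_continuousOn {E : Type*} [TopologicalSpace E] [MeasurableSpace E]
    [BorelSpace E] [Zero E] {f : ℂ → E} {s : Set ℂ}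
    (hf : ContinuousOn f s) (hs : MeasurableSet s) : Measurable (s.indicator f) := by
  classical
  rw [← Set.piecewise_eq_indicator]
  exact hf.measurable_piecewise continuousOn_const hs

/-- The area form of the mean value inequality for the modulus of an analytic function. -/
lemma area_mul_enorm_le_lintegral_ball {f : ℂ → ℂ} {z : ℂ} {r : ℝ}
    (hf : DifferentiableOn ℂ f (Metric.ball z r)) (hr : 0 < r) :
    ENNReal.ofReal (Real.pi * r ^ 2) * ‖f z‖ₑ ≤ ∫⁻ w in Metric.ball z r, ‖f w‖ₑ := by
  set F : ℂ → ℝ≥0∞ := (Metric.ball z r).indicator fun w => ‖f w‖ₑ with hF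
  have hFm : Measurable F :=
    measurable_indicator_of_continuousOn hf.continuousOn.enorm Metric.isOpen_ball.measurableSet
  have h1 : ∫⁻ w in Metric.ball z r, ‖f w‖ₑ = ∫⁻ w, F (z + w) := by
    rw [lintegral_add_left_eq_self F z, hF, lintegral_indicator Metric.isOpen_ball.measurableSet]
  rw [h1, lintegral_polar' (F := fun w => F (z + w)) (by fun_prop)]
  have h2 : ∫⁻ t in Ioo (0 : ℝ) r, ENNReal.ofReal t * (ENNReal.ofReal (2 * Real.pi) * ‖f z‖ₑ) ≤
      ∫⁻ t in Ioi (0 : ℝ), ENNReal.ofReal t *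
        ∫⁻ θ in Ioo (-Real.pi) Real.pi, F (z + circleMap 0 t θ) := by
    refine (setLIntegral_mono' measurableSet_Ioo fun t ht => ?_).trans
      (lintegral_mono_set Ioo_subset_Ioi_self)
    gcongr
    refine (two_pi_mul_enorm_le_lintegral_circle (t := t) ht.1 ?_).trans
      (lintegral_mono fun θ => ?_)
    · apply DifferentiableOn.diffContOnCl
      apply hf.mono
      refine Metric.closure_ball_subset_closedBall.trans ?_
      exact Metric.closedBall_subset_ball ht.2
    · have : z + circleMap 0 t θ = circleMap z t θ := by simp [circleMap]
      rw [this, hF, indicator_of_mem]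
      exact Metric.closedBall_subset_ball ht.2 (circleMap_mem_closedBall z ht.1.le θ)
  refine le_trans (le_of_eq ?_) h2
  rw [lintegral_mul_const _ (by fun_prop), ← ofReal_integral_eq_lintegral_ofReal]
  · have : ∫ t in Ioo 0 r, t = r ^ 2 / 2 := by
      rw [← integral_Ioc_eq_integral_Ioo, ← intervalIntegral.integral_of_le hr.le, integral_id]
      ring
    rw [this, ← mul_assoc, ← ENNReal.ofReal_mul (by positivity)]
    congr 2
    ring
  · exact (continuous_id.integrableOn_Icc (a := 0) (b := r)).mono_set Ioo_subset_Icc_self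
  · filter_upwards [self_mem_ae_restrict measurableSet_Ioo] with t ht using ht.1.le

lemma exists_rpow_submean_of_le_one {q : ℝ} (hq : 0 < q) (hq1 : q ≤ 1) :
    ∃ C : ℝ, 0 < C ∧ ∀ (k : ℂ → ℂ) (z : ℂ) (r : ℝ), 0 < r →
      DifferentiableOn ℂ k (Metric.ball z r) →
      ENNReal.ofReal (r ^ 2 * ‖k z‖ ^ q) ≤
        ENNReal.ofReal C * ∫⁻ w in Metric.ball z r, ENNReal.ofReal (‖k w‖ ^ q) := by
  have hpi := Real.pi_pos
  refine ⟨16 * 4 ^ ((1 - q) / q) / Real.pi, by positivity, fun k z r hr hk => ?_⟩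
  set R := r / 2 with hR
  have hR0 : 0 < R := by positivity
  have hRr : Metric.closedBall z R ⊆ Metric.ball z r :=
    Metric.closedBall_subset_ball (by rw [hR]; linarith)
  have hcont : ContinuousOn (fun w => ‖k w‖ ^ q * (R - ‖w - z‖) ^ 2) (Metric.closedBall z R) := by
    apply ContinuousOn.mul
    · exact (hk.continuousOn.mono hRr).norm.rpow_const fun _ _ => Or.inr hq.le
    · fun_prop
  obtain ⟨w₀, hw₀, hmax⟩ := (isCompact_closedBall z R).exists_isMaxOn
    ⟨z, Metric.mem_closedBall_self hR0.le⟩ hcont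
  have hz := hmax (Metric.mem_closedBall_self hR0.le)
  simp only [sub_self, norm_zero, sub_zero, mem_ofPred_eq] at hz
  rcases eq_or_ne (k z) 0 with h0 | h0
  · simp [h0, Real.zero_rpow hq.ne']
  have hkz : 0 < ‖k z‖ := norm_pos_iff.2 h0
  have hpos : 0 < ‖k w₀‖ ^ q * (R - ‖w₀ - z‖) ^ 2 := lt_of_lt_of_le (by positivity) hz
  have hw₀' : ‖w₀ - z‖ ≤ R := by simpa [dist_eq_norm] using hw₀
  set a := ‖k w₀‖ with ha
  have ha0 : 0 < a := by
    rcases (norm_nonneg (k w₀)).eq_or_lt with h | h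
    · rw [ha, ← h, Real.zero_rpow hq.ne', zero_mul] at hpos; exact absurd hpos (lt_irrefl _)
    · exact h
  set d := (R - ‖w₀ - z‖) / 2 with hd
  have hd0 : 0 < d := by
    have : R - ‖w₀ - z‖ ≠ 0 := fun h => by rw [h] at hpos; norm_num at hpos
    have : 0 < R - ‖w₀ - z‖ := lt_of_le_of_ne (by linarith) this.symm
    positivity
  have hsub : Metric.ball w₀ d ⊆ Metric.closedBall z R := by
    intro w hw
    rw [Metric.mem_ball, dist_eq_norm] at hw
    rw [Metric.mem_closedBall, dist_eq_norm]
    have : ‖w - z‖ ≤ ‖w - w₀‖ + ‖w₀ - z‖ := norm_sub_le_norm_sub_add_norm_sub _ _ _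
    linarith
  have hbd : ∀ w ∈ Metric.ball w₀ d, ‖k w‖ ^ q ≤ 4 * a ^ q := by
    intro w hw
    have h1 := hmax (hsub hw)
    simp only [mem_ofPred_eq] at h1
    rw [Metric.mem_ball, dist_eq_norm] at hw
    have : ‖w - z‖ ≤ ‖w - w₀‖ + ‖w₀ - z‖ := norm_sub_le_norm_sub_add_norm_sub _ _ _
    have h2 : d ≤ R - ‖w - z‖ := by linarith
    have h3 : d ^ 2 ≤ (R - ‖w - z‖) ^ 2 := by gcongr
    have h4 : R - ‖w₀ - z‖ = 2 * d := by rw [hd]; ring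
    rw [h4] at h1
    have h5 : ‖k w‖ ^ q * d ^ 2 ≤ (4 * a ^ q) * d ^ 2 := by
      calc ‖k w‖ ^ q * d ^ 2 ≤ ‖k w‖ ^ q * (R - ‖w - z‖) ^ 2 := by gcongr
        _ ≤ a ^ q * (2 * d) ^ 2 := h1
        _ = _ := by ring
    exact le_of_mul_le_mul_right h5 (by positivity)
  set c₁ : ℝ := 4 ^ ((1 - q) / q) with hc₁
  have hc₁0 : 0 < c₁ := by positivity
  have hbd2 : ∀ w ∈ Metric.ball w₀ d, ‖k w‖ ≤ (c₁ * a ^ (1 - q)) * ‖k w‖ ^ q := by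
    intro w hw
    rcases (norm_nonneg (k w)).eq_or_lt with h | h
    · rw [← h, Real.zero_rpow hq.ne']; simp
    calc ‖k w‖ = ‖k w‖ ^ (1 - q) * ‖k w‖ ^ q := by
          rw [← Real.rpow_add h]; simp
      _ = (‖k w‖ ^ q) ^ ((1 - q) / q) * ‖k w‖ ^ q := by
          rw [← Real.rpow_mul h.le]; congr 2; field_simp
      _ ≤ (4 * a ^ q) ^ ((1 - q) / q) * ‖k w‖ ^ q := by
          have : 0 ≤ (1 - q) / q := div_nonneg (by linarith) hq.le
          gcongr
          exact hbd w hw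
      _ = _ := by
          rw [Real.mul_rpow (by norm_num) (by positivity), ← Real.rpow_mul ha0.le]
          congr 3; field_simp
  have hmean := area_mul_enorm_le_lintegral_ball (hk.mono (hsub.trans hRr)) hd0
  have hint : ∫⁻ w in Metric.ball w₀ d, ‖k w‖ₑ ≤ ENNReal.ofReal (c₁ * a ^ (1 - q)) *
      ∫⁻ w in Metric.ball z r, ENNReal.ofReal (‖k w‖ ^ q) := by
    rw [← lintegral_const_mul' _ _ ENNReal.ofReal_ne_top]
    refine (setLIntegral_mono' Metric.isOpen_ball.measurableSet fun w hw => ?_).trans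
      (lintegral_mono_set (hsub.trans hRr))
    rw [← ENNReal.ofReal_mul (by positivity), ← ofReal_norm]
    exact ENNReal.ofReal_le_ofReal (hbd2 w hw)
  have h6 := hmean.trans hint
  -- multiply by the factor `a ^ (q - 1)`
  have h7 : ENNReal.ofReal (Real.pi * d ^ 2 * a ^ q) ≤ ENNReal.ofReal c₁ *
      ∫⁻ w in Metric.ball z r, ENNReal.ofReal (‖k w‖ ^ q) := by
    have h8 := mul_le_mul_right h6 (ENNReal.ofReal (a ^ (q - 1)))
    rw [← ofReal_norm, ← ENNReal.ofReal_mul (by positivity), ← ENNReal.ofReal_mul (by positivity),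
      ← mul_assoc (ENNReal.ofReal _), ← ENNReal.ofReal_mul (by positivity)] at h8
    have e1 : a ^ (q - 1) * (Real.pi * d ^ 2 * ‖k w₀‖) = Real.pi * d ^ 2 * a ^ q := by
      rw [← ha, show a ^ q = a ^ (q - 1) * a by rw [← Real.rpow_add_one ha0.ne']; congr 1; ring]
      ring
    have e2 : a ^ (q - 1) * (c₁ * a ^ (1 - q)) = c₁ := by
      rw [mul_left_comm, ← Real.rpow_add ha0]; simp
    rwa [e1, e2] at h8
  have h9 : r ^ 2 * ‖k z‖ ^ q ≤ (16 / Real.pi) * (Real.pi * d ^ 2 * a ^ q) := by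
    have h4 : R - ‖w₀ - z‖ = 2 * d := by rw [hd]; ring
    rw [h4] at hz
    have : (16 / Real.pi) * (Real.pi * d ^ 2 * a ^ q) = 4 * (a ^ q * (2 * d) ^ 2) := by
      field_simp; ring
    rw [this, show r = 2 * R by rw [hR]; ring]
    linarith
  calc ENNReal.ofReal (r ^ 2 * ‖k z‖ ^ q)
      ≤ ENNReal.ofReal ((16 / Real.pi) * (Real.pi * d ^ 2 * a ^ q)) := ENNReal.ofReal_le_ofReal h9
    _ = ENNReal.ofReal (16 / Real.pi) * ENNReal.ofReal (Real.pi * d ^ 2 * a ^ q) :=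
        ENNReal.ofReal_mul (by positivity)
    _ ≤ ENNReal.ofReal (16 / Real.pi) * (ENNReal.ofReal c₁ *
          ∫⁻ w in Metric.ball z r, ENNReal.ofReal (‖k w‖ ^ q)) := by gcongr
    _ = _ := by
        rw [← mul_assoc, ← ENNReal.ofReal_mul (by positivity)]
        congr 2; ring

/-- The sub-mean value property of `|k|^q`, `0 < q < ∞`, up to a constant. -/
lemma exists_rpow_submean {q : ℝ} (hq : 0 < q) :
    ∃ C : ℝ, 0 < C ∧ ∀ (k : ℂ → ℂ) (z : ℂ) (r : ℝ), 0 < r →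
      DifferentiableOn ℂ k (Metric.ball z r) →
      ENNReal.ofReal (r ^ 2 * ‖k z‖ ^ q) ≤
        ENNReal.ofReal C * ∫⁻ w in Metric.ball z r, ENNReal.ofReal (‖k w‖ ^ q) := by
  obtain ⟨N, hN⟩ := exists_nat_ge q
  have hN0 : (0 : ℝ) < N := hq.trans_le hN
  obtain ⟨C, hC, h⟩ := exists_rpow_submean_of_le_one (q := q / N) (by positivity)
    ((div_le_one hN0).2 hN)
  refine ⟨C, hC, fun k z r hr hk => ?_⟩
  have key : ∀ w, ‖k w ^ N‖ ^ (q / N) = ‖k w‖ ^ q := fun w => by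
    rw [norm_pow, ← Real.rpow_natCast, ← Real.rpow_mul (norm_nonneg _)]
    congr 1; field_simp
  have := h (fun w => k w ^ N) z r hr (hk.pow N)
  simpa only [key] using this

/-! ### A Littlewood–Paley inequality for weights that decay along a radial shift -/

/-- An increasing radial scale `λ ≥ 1` on `[0,1)`. The discs on which it is regarded as constant
have radius `c / λ`; the constant `K` measures its variation at that distance. -/
structure RadialScale (lam : ℝ → ℝ) (c K : ℝ) : Prop where
  measurable : Measurable lam
  one_le : ∀ r ∈ Ico (0 : ℝ) 1, 1 ≤ lam r
  mono : MonotoneOn lam (Ico 0 1)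
  diff : DifferentiableOn ℝ lam (Ioo 0 1)
  c_pos : 0 < c
  step_lt : ∀ r ∈ Ico (0 : ℝ) 1, r + c / lam r < 1
  doubling : ∀ r ∈ Ico (0 : ℝ) 1, lam (r + c / lam r) ≤ K * lam r

/-- The radius `r - c / (2 λ(r))`. -/
noncomputable def shift (lam : ℝ → ℝ) (c r : ℝ) : ℝ := r - c / (2 * lam r)

/-- The point with the argument of `z` and the modulus `shift lam c ‖z‖`. -/
noncomputable def shiftPoint (lam : ℝ → ℝ) (c : ℝ) (z : ℂ) : ℂ :=
  ((shift lam c ‖z‖ / ‖z‖ : ℝ) : ℂ) * z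

/-- A positive weight which varies by bounded factors at the scale `c / λ` and in the disc of
radius `r₀ + c / λ(r₀)`, and outside the disc of radius `r₀` decays by a factor `q` under the
radial shift, in the sense of the measure `V(r e^{iθ}) r dr`. -/
structure IsShiftDecaying (lam : ℝ → ℝ) (c A q r₀ : ℝ) (V : ℂ → ℝ) : Prop where
  continuousOn : ContinuousOn V disc
  pos : ∀ z ∈ disc, 0 < V z
  le_mul_near : ∀ z ∈ disc, ∀ w, ‖w - z‖ < c / lam ‖z‖ → V z ≤ A * V w
  le_mul_shift : ∀ z ∈ disc, r₀ ≤ ‖z‖ →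
    V z ≤ q * (V (shiftPoint lam c z) * (shift lam c ‖z‖ / ‖z‖))
  le_mul_center : ∀ z w, ‖z‖ ≤ r₀ → ‖w‖ ≤ r₀ + c / lam r₀ → V z ≤ A * V w

lemma mem_disc {z : ℂ} : z ∈ disc ↔ ‖z‖ < 1 := by simp [disc]

lemma isOpen_disc : IsOpen disc := Metric.isOpen_ball

lemma measurableSet_disc : MeasurableSet disc := isOpen_disc.measurableSet

lemma norm_mem_Ico {z : ℂ} (hz : z ∈ disc) : ‖z‖ ∈ Ico (0 : ℝ) 1 := ⟨norm_nonneg z, mem_disc.1 hz⟩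

lemma exists_add_rpow_le {p θ : ℝ} (hp : 0 < p) (hθ : 1 < θ) :
    ∃ C : ℝ, 0 < C ∧ ∀ a b : ℝ, 0 ≤ a → 0 ≤ b → (a + b) ^ p ≤ θ * a ^ p + C * b ^ p := by
  set x := θ ^ (1 / p) - 1 with hx
  have hx0 : 0 < x := by
    rw [hx, sub_pos]; exact Real.one_lt_rpow hθ (by positivity)
  have hxp : (1 + x) ^ p = θ := by
    rw [hx, add_sub_cancel, ← Real.rpow_mul (by positivity)]; field_simp; simp
  refine ⟨(1 / x + 1) ^ p, by positivity, fun a b ha hb => ?_⟩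
  rcases le_total b (x * a) with h | h
  · calc (a + b) ^ p ≤ ((1 + x) * a) ^ p := by gcongr; linarith
      _ = θ * a ^ p := by rw [Real.mul_rpow (by positivity) ha, hxp]
      _ ≤ _ := le_add_of_nonneg_right (by positivity)
  · have : a ≤ 1 / x * b := by
      rw [one_div, ← div_eq_inv_mul, le_div_iff₀ hx0]; linarith
    calc (a + b) ^ p ≤ ((1 / x + 1) * b) ^ p := by gcongr; linarith
      _ = (1 / x + 1) ^ p * b ^ p := by rw [Real.mul_rpow (by positivity) hb]
      _ ≤ _ := le_add_of_nonneg_left (by positivity)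

lemma exists_norm_sub_le_norm_deriv {h k : ℂ → ℂ} (hk : DifferentiableOn ℂ k disc)
    (hh : ∀ z ∈ disc, HasDerivAt h (k z) z) {x y : ℂ} (hx : x ∈ disc) (hy : y ∈ disc) :
    ∃ w ∈ segment ℝ x y, ‖h y - h x‖ ≤ ‖k w‖ * ‖y - x‖ := by
  have hsub : segment ℝ x y ⊆ disc := (convex_ball (0 : ℂ) 1).segment_subset hx hy
  have hcomp : IsCompact (segment ℝ x y) := by
    rw [segment_eq_image_lineMap]
    exact isCompact_Icc.image AffineMap.lineMap_continuous
  obtain ⟨w, hw, hmax⟩ := hcomp.exists_isMaxOn ⟨x, left_mem_segment ℝ x y⟩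
    (hk.continuousOn.norm.mono hsub)
  refine ⟨w, hw, ?_⟩
  exact (convex_segment x y).norm_image_sub_le_of_norm_hasDerivWithin_le
    (fun z hz => (hh z (hsub hz)).hasDerivWithinAt) (fun z hz => hmax hz)
    (left_mem_segment ℝ x y) (right_mem_segment ℝ x y)

namespace RadialScale

variable {lam : ℝ → ℝ} {c K : ℝ}

lemma pos (hl : RadialScale lam c K) {r : ℝ} (hr : r ∈ Ico (0 : ℝ) 1) : 0 < lam r :=
  zero_lt_one.trans_le (hl.one_le r hr)

lemma step_mem (hl : RadialScale lam c K) {r : ℝ} (hr : r ∈ Ico (0 : ℝ) 1) :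
    r + c / lam r ∈ Ico (0 : ℝ) 1 :=
  ⟨by have := hl.pos hr; have := hl.c_pos; have := hr.1; positivity, hl.step_lt r hr⟩

lemma one_le_const (hl : RadialScale lam c K) : 1 ≤ K := by
  have h0 : (0 : ℝ) ∈ Ico (0 : ℝ) 1 := by simp
  have h := hl.doubling 0 h0
  have h1 := hl.pos h0
  have h2 : lam 0 ≤ lam (0 + c / lam 0) := hl.mono h0 (hl.step_mem h0) (by
    have := hl.c_pos; simp; positivity)
  nlinarith

lemma near (hl : RadialScale lam c K) {z w : ℂ} (hz : z ∈ disc) (hw : ‖w - z‖ < c / lam ‖z‖) :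
    w ∈ disc ∧ lam ‖w‖ ≤ K * lam ‖z‖ ∧ lam ‖z‖ ≤ K * lam ‖w‖ := by
  have hz' := norm_mem_Ico hz
  have h1 : ‖w‖ < ‖z‖ + c / lam ‖z‖ := by
    have := norm_sub_norm_le w z; linarith
  have h2 : ‖z‖ < ‖w‖ + c / lam ‖z‖ := by
    have := norm_sub_norm_le z w; rw [norm_sub_rev] at this; linarith
  have hwd : w ∈ disc := mem_disc.2 (h1.trans (hl.step_lt _ hz'))
  have hw' := norm_mem_Ico hwd
  refine ⟨hwd, (hl.mono hw' (hl.step_mem hz') h1.le).trans (hl.doubling _ hz'), ?_⟩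
  rcases le_total ‖z‖ ‖w‖ with h | h
  · calc lam ‖z‖ ≤ lam ‖w‖ := hl.mono hz' hw' h
      _ ≤ K * lam ‖w‖ := le_mul_of_one_le_left (hl.pos hw').le hl.one_le_const
  · have h3 : lam ‖w‖ ≤ lam ‖z‖ := hl.mono hw' hz' h
    have h4 : c / lam ‖z‖ ≤ c / lam ‖w‖ :=
      div_le_div_of_nonneg_left hl.c_pos.le (hl.pos hw') h3
    exact (hl.mono hz' (hl.step_mem hw') (by linarith)).trans (hl.doubling _ hw')

lemma shift_lt (hl : RadialScale lam c K) {r : ℝ} (hr : r ∈ Ico (0 : ℝ) 1) : shift lam c r < r := by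
  have := hl.pos hr; have := hl.c_pos
  rw [shift, sub_lt_self_iff]; positivity

lemma shift_pos (hl : RadialScale lam c K) {r : ℝ} (hr : r ∈ Ico (0 : ℝ) 1) (h : c / 2 < r) :
    0 < shift lam c r := by
  rw [shift, sub_pos]
  refine lt_of_le_of_lt ?_ h
  have := hl.one_le r hr; have := hl.c_pos
  apply div_le_div_of_nonneg_left <;> linarith

/-- The radial shift expands distances, since `c / λ` is decreasing; so it does not increase
integrals of nonnegative functions. -/
lemma lintegral_shift_le (hl : RadialScale lam c K) {r₀ R : ℝ} (hr₀ : c / 2 < r₀) (hR : R ≤ 1)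
    (G : ℝ → ℝ≥0∞) :
    ∫⁻ r in Ico r₀ R, G (shift lam c r) ≤ ∫⁻ r in Ioo 0 R, G r := by
  have hc := hl.c_pos
  have hsub : Ico r₀ R ⊆ Ioo 0 1 := fun r hr => ⟨by linarith [hr.1], hr.2.trans_le hR⟩
  have hsub' : Ioo (0 : ℝ) 1 ⊆ Ico 0 1 := Ioo_subset_Ico_self
  have hderiv : ∀ r ∈ Ioo (0 : ℝ) 1, HasDerivAt (shift lam c)
      (1 + c * deriv lam r / (2 * lam r ^ 2)) r := by
    intro r hr
    have h1 : HasDerivAt lam (deriv lam r) r :=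
      ((hl.diff r hr).differentiableAt (isOpen_Ioo.mem_nhds hr)).hasDerivAt
    have h0 := (hl.pos (hsub' hr)).ne'
    have h2 := (hasDerivAt_id r).sub ((hasDerivAt_const r c).div (h1.const_mul 2)
      (mul_ne_zero two_ne_zero h0))
    refine HasDerivAt.congr_deriv (f := shift lam c) h2 ?_
    field_simp
    ring
  have hnonneg : ∀ r ∈ Ioo (0 : ℝ) 1, 0 ≤ deriv lam r := by
    intro r hr
    have := (hl.mono.mono hsub').derivWithin_nonneg (x := r)
    rwa [derivWithin_of_mem_nhds (isOpen_Ioo.mem_nhds hr)] at this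
  have hstrict : StrictMonoOn (shift lam c) (Ioo 0 1) := by
    intro x hx y hy hxy
    have h1 := hl.mono (hsub' hx) (hsub' hy) hxy.le
    have h2 := hl.pos (hsub' hx)
    have : c / (2 * lam y) ≤ c / (2 * lam x) := by gcongr
    simp only [shift]
    linarith
  have himage := lintegral_image_eq_lintegral_abs_deriv_mul measurableSet_Ico
    (fun r hr => (hderiv r (hsub hr)).hasDerivWithinAt) (hstrict.injOn.mono hsub) G
  calc ∫⁻ r in Ico r₀ R, G (shift lam c r)
      ≤ ∫⁻ r in Ico r₀ R,
        ENNReal.ofReal |1 + c * deriv lam r / (2 * lam r ^ 2)| * G (shift lam c r) := by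
        refine setLIntegral_mono' measurableSet_Ico fun r hr => le_mul_of_one_le_left zero_le ?_
        rw [ENNReal.one_le_ofReal]
        have := hnonneg r (hsub hr)
        exact (le_add_of_nonneg_right (by positivity)).trans (le_abs_self _)
    _ = ∫⁻ r in shift lam c '' Ico r₀ R, G r := himage.symm
    _ ≤ ∫⁻ r in Ioo 0 R, G r := by
        apply lintegral_mono_set
        rintro _ ⟨r, hr, rfl⟩
        have hr' := hsub' (hsub hr)
        exact ⟨hl.shift_pos hr' (hr₀.trans_le hr.1), (hl.shift_lt hr').trans hr.2⟩

lemma measurable_shift (hl : RadialScale lam c K) : Measurable (shift lam c) := by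
  have := hl.measurable
  unfold shift; fun_prop

lemma measurable_shiftPoint (hl : RadialScale lam c K) : Measurable (shiftPoint lam c) := by
  have := hl.measurable_shift
  unfold shiftPoint; fun_prop

lemma norm_shiftPoint_sub (hl : RadialScale lam c K) {z : ℂ} (hz : z ∈ disc) (h0 : c / 2 < ‖z‖) :
    ‖shiftPoint lam c z - z‖ = c / lam ‖z‖ / 2 ∧ shiftPoint lam c z ∈ disc ∧
      ‖shiftPoint lam c z‖ = shift lam c ‖z‖ := by
  have hz' := norm_mem_Ico hz
  have hc := hl.c_pos
  have hn : 0 < ‖z‖ := by linarith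
  have h1 := hl.shift_pos hz' h0
  have h2 : ‖shiftPoint lam c z‖ = shift lam c ‖z‖ := by
    rw [shiftPoint, norm_mul, Complex.norm_real, Real.norm_of_nonneg (by positivity)]
    field_simp
  refine ⟨?_, mem_disc.2 (h2 ▸ (hl.shift_lt hz').trans hz'.2), h2⟩
  have h3 : shiftPoint lam c z - z = ((shift lam c ‖z‖ / ‖z‖ - 1 : ℝ) : ℂ) * z := by
    rw [shiftPoint]; push_cast; ring
  have h4 : shift lam c ‖z‖ / ‖z‖ - 1 = -(c / lam ‖z‖ / 2 / ‖z‖) := by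
    rw [shift]; have := (hl.pos hz').ne'; field_simp; ring
  have := hl.pos hz'
  rw [h3, h4, norm_mul, Complex.norm_real, norm_neg, Real.norm_of_nonneg (by positivity)]
  field_simp

lemma lintegral_shiftPoint_le (hl : RadialScale lam c K) {r₀ R : ℝ} (hr₀ : c / 2 < r₀) (hR : R ≤ 1)
    {F : ℂ → ℝ≥0∞} (hF : Measurable F) :
    ∫⁻ z in Metric.ball 0 R \ Metric.ball 0 r₀,
        ENNReal.ofReal (shift lam c ‖z‖ / ‖z‖) * F (shiftPoint lam c z) ≤
      ∫⁻ z in Metric.ball 0 R, F z := by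
  have hc := hl.c_pos
  have hms := hl.measurable_shift
  have hmp := hl.measurable_shiftPoint
  have hmeas : MeasurableSet (Metric.ball (0 : ℂ) R \ Metric.ball 0 r₀) :=
    Metric.isOpen_ball.measurableSet.diff Metric.isOpen_ball.measurableSet
  rw [← lintegral_indicator hmeas, ← lintegral_indicator Metric.isOpen_ball.measurableSet,
    lintegral_polar (Measurable.indicator (by fun_prop) hmeas),
    lintegral_polar (hF.indicator Metric.isOpen_ball.measurableSet)]
  refine lintegral_mono fun θ => ?_
  calc _ ≤ ∫⁻ r in Ioi (0 : ℝ), (Ico r₀ R).indicator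
          (fun r => ENNReal.ofReal (shift lam c r) * F (circleMap 0 (shift lam c r) θ)) r := by
        refine setLIntegral_mono' measurableSet_Ioi fun r (hr : 0 < r) => ?_
        have hnorm : ‖circleMap 0 r θ‖ = r := by simp [abs_of_pos hr]
        by_cases hmem : r ∈ Ico r₀ R
        · rw [indicator_of_mem hmem, indicator_of_mem (by simpa [abs_of_pos hr] using hmem.symm),
            hnorm, ← mul_assoc, ← ENNReal.ofReal_mul hr.le]
          have : shiftPoint lam c (circleMap 0 r θ) = circleMap 0 (shift lam c r) θ := by
            rw [shiftPoint, hnorm, circleMap, circleMap]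
            push_cast
            have : (r : ℂ) ≠ 0 := by exact_mod_cast hr.ne'
            field_simp
            simp
            ring
          rw [this, mul_div_cancel₀ _ hr.ne']
        · rw [indicator_of_notMem hmem, indicator_of_notMem, mul_zero]
          simpa [abs_of_pos hr, and_comm] using hmem
    _ ≤ ∫⁻ r in Ico r₀ R, ENNReal.ofReal (shift lam c r) * F (circleMap 0 (shift lam c r) θ) := by
        rw [← lintegral_indicator measurableSet_Ico]
        exact setLIntegral_le_lintegral _ _
    _ ≤ ∫⁻ r in Ioo 0 R, ENNReal.ofReal r * F (circleMap 0 r θ) :=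
        hl.lintegral_shift_le hr₀ hR fun r => ENNReal.ofReal r * F (circleMap 0 r θ)
    _ ≤ _ := by
        refine (setLIntegral_mono' measurableSet_Ioo fun r hr => ?_).trans
          (lintegral_mono_set Ioo_subset_Ioi_self)
        rw [indicator_of_mem]
        simpa [abs_of_pos hr.1] using hr.2

end RadialScale

section LittlewoodPaley

variable {lam : ℝ → ℝ} {c K : ℝ}

lemma RadialScale.exists_increment_le (hl : RadialScale lam c K) {p : ℝ} (hp : 0 < p) :
    ∃ C : ℝ, 0 < C ∧ ∀ h k : ℂ → ℂ, (∀ z ∈ disc, HasDerivAt h (k z) z) →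
      DifferentiableOn ℂ k disc → ∀ z ∈ disc, c / 2 < ‖z‖ →
      ENNReal.ofReal (‖h z - h (shiftPoint lam c z)‖ ^ p) ≤
        ENNReal.ofReal (C * ((1 / lam ‖z‖) ^ p * lam ‖z‖ ^ 2)) *
          ∫⁻ w in Metric.ball z (c / lam ‖z‖), ENNReal.ofReal (‖k w‖ ^ p) := by
  obtain ⟨C, hC, hsub⟩ := exists_rpow_submean hp
  have hc := hl.c_pos
  refine ⟨(c / 2) ^ p * (2 / c) ^ 2 * C, by positivity, fun h k hh hk z hz hz0 => ?_⟩
  have hz' := norm_mem_Ico hz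
  have hlam := hl.pos hz'
  obtain ⟨e1, e2, e3⟩ := hl.norm_shiftPoint_sub hz hz0
  obtain ⟨w, hw, hle⟩ := exists_norm_sub_le_norm_deriv hk hh e2 hz
  set ρ := c / lam ‖z‖ with hρ
  have hρ0 : 0 < ρ := by positivity
  rw [norm_sub_rev z, e1] at hle
  have hwz : ‖w - z‖ ≤ ρ / 2 := by
    have : w ∈ Metric.closedBall z (ρ / 2) := by
      refine (convex_closedBall z (ρ / 2)).segment_subset ?_ ?_ hw
      · rw [Metric.mem_closedBall, dist_eq_norm, e1]
      · exact Metric.mem_closedBall_self (by positivity)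
    simpa [dist_eq_norm] using this
  have hball : Metric.ball w (ρ / 2) ⊆ Metric.ball z ρ := by
    apply Metric.ball_subset_ball'
    rw [dist_eq_norm]; linarith
  have hdisc : Metric.ball z ρ ⊆ disc := fun x hx => (hl.near hz (by
    simpa [dist_eq_norm] using hx)).1
  have hm := hsub k w (ρ / 2) (by positivity) (hk.mono (hball.trans hdisc))
  have hreal : ‖h z - h (shiftPoint lam c z)‖ ^ p ≤
      ((c / 2) ^ p * (2 / c) ^ 2 * ((1 / lam ‖z‖) ^ p * lam ‖z‖ ^ 2)) *
        ((ρ / 2) ^ 2 * ‖k w‖ ^ p) := by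
    calc ‖h z - h (shiftPoint lam c z)‖ ^ p ≤ (‖k w‖ * (ρ / 2)) ^ p := by gcongr
      _ = (c / 2 * (1 / lam ‖z‖)) ^ p * ‖k w‖ ^ p := by
          rw [Real.mul_rpow (by positivity) (by positivity), mul_comm, hρ]
          congr 2; field_simp
      _ = _ := by
          rw [Real.mul_rpow (by positivity) (by positivity), hρ]
          field_simp
  calc _ ≤ ENNReal.ofReal _ := ENNReal.ofReal_le_ofReal hreal
    _ = ENNReal.ofReal ((c / 2) ^ p * (2 / c) ^ 2 * ((1 / lam ‖z‖) ^ p * lam ‖z‖ ^ 2)) *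
          ENNReal.ofReal ((ρ / 2) ^ 2 * ‖k w‖ ^ p) := ENNReal.ofReal_mul (by positivity)
    _ ≤ ENNReal.ofReal ((c / 2) ^ p * (2 / c) ^ 2 * ((1 / lam ‖z‖) ^ p * lam ‖z‖ ^ 2)) *
          (ENNReal.ofReal C * ∫⁻ w in Metric.ball z ρ, ENNReal.ofReal (‖k w‖ ^ p)) := by
        gcongr
        exact hm.trans (by gcongr)
    _ = _ := by
        rw [← mul_assoc, ← ENNReal.ofReal_mul (by positivity)]
        congr 2; ring

/-- The local averages that dominate the increments of a primitive integrate, by Fubini's theorem,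
to the right-hand side of the Littlewood–Paley inequality. -/
lemma RadialScale.lintegral_average_le (hl : RadialScale lam c K) {p : ℝ} (hp : 0 < p) {A : ℝ}
    (hA : 0 < A) :
    ∃ C : ℝ, 0 < C ∧ ∀ V : ℂ → ℝ, ContinuousOn V disc → (∀ z ∈ disc, 0 < V z) →
      (∀ z ∈ disc, ∀ w, ‖w - z‖ < c / lam ‖z‖ → V z ≤ A * V w) →
      ∀ k : ℂ → ℂ, ContinuousOn k disc →
      ∫⁻ z in disc, ENNReal.ofReal ((1 / lam ‖z‖) ^ p * lam ‖z‖ ^ 2 * V z) *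
          ∫⁻ w in Metric.ball z (c / lam ‖z‖), ENNReal.ofReal (‖k w‖ ^ p) ≤
        ENNReal.ofReal C * ∫⁻ w in disc, ENNReal.ofReal ((‖k w‖ / lam ‖w‖) ^ p * V w) := by
  have hc := hl.c_pos
  have hK : 0 < K := zero_lt_one.trans_le hl.one_le_const
  have hlm := hl.measurable
  set D := K ^ p * K ^ 2 * A with hD
  have hD0 : 0 < D := by positivity
  refine ⟨D * (Real.pi * (K * c) ^ 2), by have := Real.pi_pos; positivity,
    fun V hVc hV hnear k hk => ?_⟩
  set G : ℂ → ℝ≥0∞ := fun w =>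
    ENNReal.ofReal (D * lam ‖w‖ ^ 2 * ((‖k w‖ / lam ‖w‖) ^ p * V w)) with hG
  have hGm : AEMeasurable G (volume.restrict disc) := by
    have h1 : AEMeasurable V (volume.restrict disc) := hVc.aemeasurable measurableSet_disc
    have h2 : AEMeasurable k (volume.restrict disc) := hk.aemeasurable measurableSet_disc
    have h3 : Measurable fun w : ℂ => lam ‖w‖ := by fun_prop
    exact ((h3.aemeasurable.pow_const 2).const_mul D).mul
      (((h2.norm.div h3.aemeasurable).pow_const p).mul h1) |>.ennreal_ofReal
  set E : Set (ℂ × ℂ) := {x | ‖x.1 - x.2‖ < K * c / lam ‖x.2‖} with hE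
  have hEm : MeasurableSet E := by
    apply measurableSet_lt <;> fun_prop
  have hpt : ∀ z ∈ disc, ENNReal.ofReal ((1 / lam ‖z‖) ^ p * lam ‖z‖ ^ 2 * V z) *
      ∫⁻ w in Metric.ball z (c / lam ‖z‖), ENNReal.ofReal (‖k w‖ ^ p) ≤
      ∫⁻ w in disc, E.indicator (fun x => G x.2) (z, w) := by
    intro z hz
    rw [← lintegral_const_mul' _ _ ENNReal.ofReal_ne_top]
    have hsub : Metric.ball z (c / lam ‖z‖) ⊆ disc := fun x hx =>
      (hl.near hz (by simpa [dist_eq_norm] using hx)).1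
    refine (setLIntegral_mono' Metric.isOpen_ball.measurableSet fun w hw => ?_).trans
      (lintegral_mono_set hsub)
    have hw' : ‖w - z‖ < c / lam ‖z‖ := by simpa [dist_eq_norm] using hw
    obtain ⟨hwd, h1, h2⟩ := hl.near hz hw'
    have hlz := hl.pos (norm_mem_Ico hz)
    have hlw := hl.pos (norm_mem_Ico hwd)
    have hinv : 1 / lam ‖z‖ ≤ K / lam ‖w‖ := by
      rw [div_le_div_iff₀ hlz hlw]; linarith
    have hmem : (z, w) ∈ E := by
      rw [hE, mem_ofPred_eq, norm_sub_rev]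
      calc ‖w - z‖ < c * (1 / lam ‖z‖) := by rw [mul_one_div]; exact hw'
        _ ≤ c * (K / lam ‖w‖) := by gcongr
        _ = _ := by ring
    rw [indicator_of_mem hmem, hG, ← ENNReal.ofReal_mul (by have := hV z hz; positivity)]
    apply ENNReal.ofReal_le_ofReal
    have hVw := hV w hwd
    have hVz := hV z hz
    calc (1 / lam ‖z‖) ^ p * lam ‖z‖ ^ 2 * V z * ‖k w‖ ^ p
        ≤ (K / lam ‖w‖) ^ p * (K * lam ‖w‖) ^ 2 * (A * V w) * ‖k w‖ ^ p := by
          gcongr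
          exact hnear z hz w hw'
      _ = _ := by
          rw [Real.div_rpow hK.le hlw.le, Real.div_rpow (norm_nonneg _) hlw.le, hD]
          ring
  calc _ ≤ ∫⁻ z in disc, ∫⁻ w in disc, E.indicator (fun x => G x.2) (z, w) :=
        setLIntegral_mono' measurableSet_disc hpt
    _ ≤ ∫⁻ z, ∫⁻ w in disc, E.indicator (fun x => G x.2) (z, w) :=
        setLIntegral_le_lintegral _ _
    _ = ∫⁻ w in disc, ∫⁻ z, E.indicator (fun x => G x.2) (z, w) := by
        apply lintegral_lintegral_swap
        exact (hGm.comp_snd (μ := volume)).indicator hEm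
    _ ≤ ∫⁻ w in disc, ENNReal.ofReal (D * (Real.pi * (K * c) ^ 2)) *
          ENNReal.ofReal ((‖k w‖ / lam ‖w‖) ^ p * V w) := by
        refine setLIntegral_mono' measurableSet_disc fun w hw => le_of_eq ?_
        have hlw := hl.pos (norm_mem_Ico hw)
        have hVw := hV w hw
        have h1 : ∀ z, E.indicator (fun x => G x.2) (z, w) =
            (Metric.ball w (K * c / lam ‖w‖)).indicator (fun _ => G w) z := fun z => by
          by_cases h : ‖z - w‖ < K * c / lam ‖w‖
          · rw [indicator_of_mem (by exact h),
              indicator_of_mem (by simpa [dist_eq_norm] using h)]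
          · rw [indicator_of_notMem (by exact h),
              indicator_of_notMem (by simpa [dist_eq_norm] using h)]
        simp_rw [h1]
        rw [lintegral_indicator Metric.isOpen_ball.measurableSet, setLIntegral_const,
          Complex.volume_ball, hG, ← ENNReal.ofReal_pow (by positivity),
          show ((NNReal.pi : ℝ≥0) : ℝ≥0∞) = ENNReal.ofReal Real.pi by
            rw [← NNReal.coe_real_pi, ENNReal.ofReal_coe_nnreal],
          ← ENNReal.ofReal_mul (by positivity), ← ENNReal.ofReal_mul (by positivity),
          ← ENNReal.ofReal_mul (by have := Real.pi_pos; positivity)]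
        congr 1
        field_simp
    _ = _ := lintegral_const_mul' _ _ ENNReal.ofReal_ne_top

lemma RadialScale.exists_center_le (hl : RadialScale lam c K) {p : ℝ} (hp : 0 < p) {A r₀ : ℝ}
    (hA : 0 < A) (hr₀ : r₀ ∈ Ico (0 : ℝ) 1) :
    ∃ C : ℝ, 0 < C ∧ ∀ V : ℂ → ℝ, (∀ z ∈ disc, 0 < V z) →
      (∀ z w, ‖z‖ ≤ r₀ → ‖w‖ ≤ r₀ + c / lam r₀ → V z ≤ A * V w) →
      ∀ h k : ℂ → ℂ, (∀ z ∈ disc, HasDerivAt h (k z) z) → h 0 = 0 → DifferentiableOn ℂ k disc →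
      ∫⁻ z in Metric.ball 0 r₀, ENNReal.ofReal (‖h z‖ ^ p * V z) ≤
        ENNReal.ofReal C * ∫⁻ w in disc, ENNReal.ofReal ((‖k w‖ / lam ‖w‖) ^ p * V w) := by
  obtain ⟨C, hC, hsub⟩ := exists_rpow_submean hp
  have hc := hl.c_pos
  have hl₀ := hl.pos hr₀
  set ρ := c / lam r₀ with hρ
  have hρ0 : 0 < ρ := by positivity
  set r₁ := r₀ + ρ with hr₁
  have hr₁' : r₁ ∈ Ico (0 : ℝ) 1 := hl.step_mem hr₀
  have hl₁ := hl.pos hr₁'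
  have hpi := Real.pi_pos
  set C₁ := (1 / ρ ^ 2) * C * (A * lam r₁ ^ p) with hC₁
  refine ⟨C₁ * Real.pi, by positivity, fun V hV hcen h k hh h0 hk => ?_⟩
  set J := ∫⁻ w in disc, ENNReal.ofReal ((‖k w‖ / lam ‖w‖) ^ p * V w) with hJ
  have hpt : ∀ z ∈ Metric.ball (0 : ℂ) r₀,
      ENNReal.ofReal (‖h z‖ ^ p * V z) ≤ ENNReal.ofReal C₁ * J := by
    intro z hz
    have hzn : ‖z‖ < r₀ := by simpa using hz
    have hzd : z ∈ disc := mem_disc.2 (hzn.trans hr₀.2)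
    have hVz := hV z hzd
    obtain ⟨w, hw, hle⟩ := exists_norm_sub_le_norm_deriv hk hh (x := 0) (by simp [disc]) hzd
    rw [h0, sub_zero, sub_zero] at hle
    have hwn : ‖w‖ ≤ r₀ := by
      have : w ∈ Metric.ball (0 : ℂ) r₀ :=
        (convex_ball (0 : ℂ) r₀).segment_subset (Metric.mem_ball_self
          ((norm_nonneg z).trans_lt hzn)) hz hw
      simpa using (show ‖w‖ < r₀ by simpa using this).le
    have hball : Metric.ball w ρ ⊆ Metric.ball 0 r₁ := by
      apply Metric.ball_subset_ball'
      rw [dist_zero_right]; linarith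
    have hdisc : Metric.ball (0 : ℂ) r₁ ⊆ disc := Metric.ball_subset_ball hr₁'.2.le
    have hm := hsub k w ρ hρ0 (hk.mono (hball.trans hdisc))
    have hreal : ‖h z‖ ^ p * V z ≤ (1 / ρ ^ 2) * V z * (ρ ^ 2 * ‖k w‖ ^ p) := by
      have h1 : ‖h z‖ ≤ ‖k w‖ := hle.trans
        (mul_le_of_le_one_right (norm_nonneg _) (mem_disc.1 hzd).le)
      calc ‖h z‖ ^ p * V z ≤ ‖k w‖ ^ p * V z := by gcongr
        _ = _ := by field_simp
    calc _ ≤ ENNReal.ofReal ((1 / ρ ^ 2) * V z * (ρ ^ 2 * ‖k w‖ ^ p)) :=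
          ENNReal.ofReal_le_ofReal hreal
      _ = ENNReal.ofReal ((1 / ρ ^ 2) * V z) * ENNReal.ofReal (ρ ^ 2 * ‖k w‖ ^ p) :=
          ENNReal.ofReal_mul (by positivity)
      _ ≤ ENNReal.ofReal ((1 / ρ ^ 2) * V z) * (ENNReal.ofReal C *
            ∫⁻ x in Metric.ball 0 r₁, ENNReal.ofReal (‖k x‖ ^ p)) := by
          gcongr
          exact hm.trans (by gcongr)
      _ = ∫⁻ x in Metric.ball 0 r₁,
            ENNReal.ofReal ((1 / ρ ^ 2) * V z * C) * ENNReal.ofReal (‖k x‖ ^ p) := by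
          rw [← mul_assoc, ← ENNReal.ofReal_mul (by positivity),
            lintegral_const_mul' _ _ ENNReal.ofReal_ne_top]
      _ ≤ ∫⁻ x in Metric.ball 0 r₁, ENNReal.ofReal C₁ *
            ENNReal.ofReal ((‖k x‖ / lam ‖x‖) ^ p * V x) := by
          refine setLIntegral_mono' Metric.isOpen_ball.measurableSet fun x hx => ?_
          have hxn : ‖x‖ < r₁ := by simpa using hx
          have hxd := hdisc hx
          have hVx := hV x hxd
          have hlx := hl.pos (norm_mem_Ico hxd)
          rw [← ENNReal.ofReal_mul (by positivity), ← ENNReal.ofReal_mul (by positivity)]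
          apply ENNReal.ofReal_le_ofReal
          have h1 : V z ≤ A * V x := hcen z x hzn.le hxn.le
          have h2 : ‖k x‖ ≤ lam r₁ * (‖k x‖ / lam ‖x‖) := by
            rw [mul_div_assoc', le_div_iff₀ hlx, mul_comm]
            gcongr
            exact hl.mono (norm_mem_Ico hxd) hr₁' hxn.le
          calc 1 / ρ ^ 2 * V z * C * ‖k x‖ ^ p
              ≤ 1 / ρ ^ 2 * (A * V x) * C * (lam r₁ * (‖k x‖ / lam ‖x‖)) ^ p := by gcongr
            _ = _ := by
              rw [Real.mul_rpow hl₁.le (by positivity), hC₁]; ring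
      _ = ENNReal.ofReal C₁ * ∫⁻ x in Metric.ball 0 r₁,
            ENNReal.ofReal ((‖k x‖ / lam ‖x‖) ^ p * V x) :=
          lintegral_const_mul' _ _ ENNReal.ofReal_ne_top
      _ ≤ ENNReal.ofReal C₁ * J := by
          gcongr
          exact lintegral_mono_set hdisc
  calc _ ≤ ∫⁻ z in Metric.ball (0 : ℂ) r₀, ENNReal.ofReal C₁ * J :=
        setLIntegral_mono' Metric.isOpen_ball.measurableSet hpt
    _ = ENNReal.ofReal C₁ * J * volume (Metric.ball (0 : ℂ) r₀) := setLIntegral_const _ _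
    _ ≤ ENNReal.ofReal C₁ * J * ENNReal.ofReal Real.pi := by
        gcongr
        rw [Complex.volume_ball, ← NNReal.coe_real_pi, ENNReal.ofReal_coe_nnreal]
        refine mul_le_of_le_one_left zero_le ?_
        rw [← ENNReal.ofReal_pow hr₀.1]
        exact ENNReal.ofReal_le_one.2 (pow_le_one₀ hr₀.1 hr₀.2.le)
    _ = _ := by
        rw [ENNReal.ofReal_mul (p := C₁) (by positivity)]; ring

/-- **Littlewood–Paley inequality.** On the annulus `r₀ ≤ |z| < R` the value `h z` is compared with
`h` at the radially shifted point; the shifted integral is at most `q` times the integral over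
`|z| < R`, which is finite, and is absorbed. -/
theorem RadialScale.littlewoodPaley (hl : RadialScale lam c K) {p : ℝ} (hp : 0 < p) {A q r₀ : ℝ}
    (hA : 0 < A) (hq0 : 0 < q) (hq : q < 1) (hcr : c / 2 < r₀) (hr₀ : r₀ < 1) :
    ∃ C : ℝ, 0 < C ∧ ∀ V : ℂ → ℝ, IsShiftDecaying lam c A q r₀ V →
      ∀ h k : ℂ → ℂ, (∀ z ∈ disc, HasDerivAt h (k z) z) → h 0 = 0 → DifferentiableOn ℂ k disc →
      ∫⁻ z in disc, ENNReal.ofReal (‖h z‖ ^ p * V z) ≤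
        ENNReal.ofReal C * ∫⁻ z in disc, ENNReal.ofReal ((‖k z‖ / lam ‖z‖) ^ p * V z) := by
  have hc := hl.c_pos
  have hr₀' : r₀ ∈ Ico (0 : ℝ) 1 := ⟨by linarith, hr₀⟩
  set κ := (1 + q) / 2 with hκ
  have hκ1 : κ < 1 := by rw [hκ]; linarith
  have hκ0 : 0 < κ := by rw [hκ]; linarith
  obtain ⟨C₁, hC₁, hadd⟩ := exists_add_rpow_le hp (θ := κ / q) (by
    rw [one_lt_div hq0, hκ]; linarith)
  obtain ⟨C₂, hC₂, hinc⟩ := hl.exists_increment_le hp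
  obtain ⟨C₃, hC₃, hfub⟩ := hl.lintegral_average_le hp hA
  obtain ⟨C₄, hC₄, hcent⟩ := hl.exists_center_le hp hA hr₀'
  set M := C₄ + C₁ * C₂ * C₃ with hM
  have hM0 : 0 < M := by positivity
  refine ⟨M / (1 - κ), div_pos hM0 (by linarith), fun V hV h k hh h0 hk => ?_⟩
  set J := ∫⁻ w in disc, ENNReal.ofReal ((‖k w‖ / lam ‖w‖) ^ p * V w) with hJ
  have hhc : ContinuousOn h disc := fun z hz => (hh z hz).continuousAt.continuousWithinAt
  set f : ℂ → ℝ := fun z => ‖h z‖ ^ p * V z with hf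
  have hfc : ContinuousOn f disc :=
    (hhc.norm.rpow_const fun _ _ => Or.inr hp.le).mul hV.continuousOn
  set Q : ℂ → ℝ≥0∞ := fun z => ENNReal.ofReal ((1 / lam ‖z‖) ^ p * lam ‖z‖ ^ 2 * V z) *
          ∫⁻ w in Metric.ball z (c / lam ‖z‖), ENNReal.ofReal (‖k w‖ ^ p) with hQ
  have hQJ : ∫⁻ z in disc, Q z ≤ ENNReal.ofReal C₃ * J :=
    hfub V hV.continuousOn hV.pos hV.le_mul_near k hk.continuousOn
  have hpt : ∀ z ∈ disc, r₀ ≤ ‖z‖ → ENNReal.ofReal (f z) ≤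
      ENNReal.ofReal κ * (ENNReal.ofReal (shift lam c ‖z‖ / ‖z‖) *
        ENNReal.ofReal (f (shiftPoint lam c z))) + ENNReal.ofReal (C₁ * C₂) * Q z := by
    intro z hz hrz
    have hcz : c / 2 < ‖z‖ := hcr.trans_le hrz
    have hz' := norm_mem_Ico hz
    have hVz := hV.pos z hz
    have hlz := hl.pos hz'
    obtain ⟨-, hsd, -⟩ := hl.norm_shiftPoint_sub hz hcz
    have hVs := hV.pos _ hsd
    have hs0 := hl.shift_pos hz' hcz
    set y := shiftPoint lam c z with hy
    have hreal : f z ≤ κ * (shift lam c ‖z‖ / ‖z‖ * f y) + C₁ * V z * ‖h z - h y‖ ^ p := by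
      have h1 : ‖h z‖ ≤ ‖h y‖ + ‖h z - h y‖ := by
        have := norm_add_le (h y) (h z - h y); rwa [add_sub_cancel] at this
      have h2 : ‖h z‖ ^ p ≤ κ / q * ‖h y‖ ^ p + C₁ * ‖h z - h y‖ ^ p :=
        (Real.rpow_le_rpow (norm_nonneg _) h1 hp.le).trans
          (hadd _ _ (norm_nonneg _) (norm_nonneg _))
      calc f z ≤ (κ / q * ‖h y‖ ^ p + C₁ * ‖h z - h y‖ ^ p) * V z := by
            simp only [hf]; gcongr
        _ = κ / q * ‖h y‖ ^ p * V z + C₁ * V z * ‖h z - h y‖ ^ p := by ring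
        _ ≤ κ / q * ‖h y‖ ^ p * (q * (V y * (shift lam c ‖z‖ / ‖z‖))) +
              C₁ * V z * ‖h z - h y‖ ^ p := by
            gcongr
            exact hV.le_mul_shift z hz hrz
        _ = _ := by simp only [hf]; field_simp
    have hfy : 0 ≤ f y := by positivity
    calc _ ≤ ENNReal.ofReal _ := ENNReal.ofReal_le_ofReal hreal
      _ = ENNReal.ofReal κ * (ENNReal.ofReal (shift lam c ‖z‖ / ‖z‖) * ENNReal.ofReal (f y)) +
          ENNReal.ofReal (C₁ * V z) * ENNReal.ofReal (‖h z - h y‖ ^ p) := by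
          have : 0 ≤ shift lam c ‖z‖ / ‖z‖ := by positivity
          rw [ENNReal.ofReal_add (by positivity) (by positivity), ENNReal.ofReal_mul hκ0.le,
            ENNReal.ofReal_mul this, ENNReal.ofReal_mul (p := C₁ * V z) (by positivity)]
      _ ≤ ENNReal.ofReal κ * (ENNReal.ofReal (shift lam c ‖z‖ / ‖z‖) * ENNReal.ofReal (f y)) +
          ENNReal.ofReal (C₁ * V z) *
            (ENNReal.ofReal (C₂ * ((1 / lam ‖z‖) ^ p * lam ‖z‖ ^ 2)) *
          ∫⁻ w in Metric.ball z (c / lam ‖z‖), ENNReal.ofReal (‖k w‖ ^ p)) := by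
          gcongr
          exact hinc h k hh hk z hz hcz
      _ = _ := by
          rw [hQ, ← mul_assoc (ENNReal.ofReal (C₁ * V z)),
            ← ENNReal.ofReal_mul (p := C₁ * V z) (by positivity),
            ← mul_assoc (ENNReal.ofReal (C₁ * C₂)),
            ← ENNReal.ofReal_mul (p := C₁ * C₂) (by positivity)]
          congr 3; ring
  have hbound : ∀ R : ℝ, R < 1 → r₀ ≤ R →
      ∫⁻ z in Metric.ball 0 R, ENNReal.ofReal (f z) ≤ ENNReal.ofReal (M / (1 - κ)) * J := by
    intro R hR hrR
    have hsub : Metric.closedBall (0 : ℂ) R ⊆ disc := Metric.closedBall_subset_ball hR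
    have hsubb : Metric.ball (0 : ℂ) R ⊆ disc := Metric.ball_subset_closedBall.trans hsub
    set I := ∫⁻ z in Metric.ball 0 R, ENNReal.ofReal (f z) with hI
    have hIfin : I ≠ ⊤ := by
      obtain ⟨B, hB⟩ := (isCompact_closedBall (0 : ℂ) R).exists_bound_of_continuousOn
        (hfc.mono hsub)
      have : I ≤ ENNReal.ofReal B * volume (Metric.ball (0 : ℂ) R) := by
        rw [← setLIntegral_const]
        refine setLIntegral_mono' Metric.isOpen_ball.measurableSet fun z hz => ?_
        exact ENNReal.ofReal_le_ofReal ((le_abs_self _).trans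
          (hB z (Metric.ball_subset_closedBall hz)))
      exact ne_top_of_le_ne_top (ENNReal.mul_ne_top ENNReal.ofReal_ne_top
        Metric.isBounded_ball.measure_lt_top.ne) this
    have hmeas : MeasurableSet (Metric.ball (0 : ℂ) R \ Metric.ball 0 r₀) :=
      Metric.isOpen_ball.measurableSet.diff Metric.isOpen_ball.measurableSet
    set F : ℂ → ℝ≥0∞ := (Metric.ball (0 : ℂ) R).indicator fun z => ENNReal.ofReal (f z) with hF
    have hFm : Measurable F := measurable_indicator_of_continuousOn
      (ENNReal.continuous_ofReal.comp_continuousOn (hfc.mono hsubb))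
      Metric.isOpen_ball.measurableSet
    have hms := hl.measurable_shift
    have hmp := hl.measurable_shiftPoint
    have hann : ∫⁻ z in Metric.ball 0 R \ Metric.ball 0 r₀, ENNReal.ofReal (f z) ≤
        ENNReal.ofReal κ * I + ENNReal.ofReal (C₁ * C₂) * (ENNReal.ofReal C₃ * J) := by
      calc _ ≤ ∫⁻ z in Metric.ball 0 R \ Metric.ball 0 r₀,
              (ENNReal.ofReal κ * (ENNReal.ofReal (shift lam c ‖z‖ / ‖z‖) *
                F (shiftPoint lam c z)) + ENNReal.ofReal (C₁ * C₂) * Q z) := by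
            refine setLIntegral_mono' hmeas fun z hz => ?_
            have hzR : ‖z‖ < R := by simpa using hz.1
            have hrz : r₀ ≤ ‖z‖ := by simpa using hz.2
            refine (hpt z (hsubb hz.1) hrz).trans_eq ?_
            rw [hF, indicator_of_mem]
            have h1 := hl.norm_shiftPoint_sub (hsubb hz.1) (hcr.trans_le hrz)
            rw [mem_ball_zero_iff, h1.2.2]
            exact (hl.shift_lt (norm_mem_Ico (hsubb hz.1))).trans hzR
        _ = ENNReal.ofReal κ * (∫⁻ z in Metric.ball 0 R \ Metric.ball 0 r₀,
              ENNReal.ofReal (shift lam c ‖z‖ / ‖z‖) * F (shiftPoint lam c z)) +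
              ENNReal.ofReal (C₁ * C₂) * ∫⁻ z in Metric.ball 0 R \ Metric.ball 0 r₀, Q z := by
            rw [lintegral_add_left (by fun_prop), lintegral_const_mul' _ _ ENNReal.ofReal_ne_top,
              lintegral_const_mul' _ _ ENNReal.ofReal_ne_top]
        _ ≤ ENNReal.ofReal κ * (∫⁻ z in Metric.ball 0 R, F z) +
              ENNReal.ofReal (C₁ * C₂) * ∫⁻ z in disc, Q z := by
            exact add_le_add (mul_le_mul_right (hl.lintegral_shiftPoint_le hcr hR.le hFm) _)
              (mul_le_mul_right (lintegral_mono_set (sdiff_subset.trans hsubb)) _)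
        _ ≤ _ := by
            rw [hI]
            refine add_le_add (mul_le_mul_right ?_ _) (mul_le_mul_right hQJ _)
            exact (setLIntegral_congr_fun Metric.isOpen_ball.measurableSet
              fun z hz => by rw [hF, indicator_of_mem hz]).le
    have htot : I ≤ ENNReal.ofReal M * J + ENNReal.ofReal κ * I := by
      have hsplit : I = (∫⁻ z in Metric.ball 0 r₀, ENNReal.ofReal (f z)) +
          ∫⁻ z in Metric.ball 0 R \ Metric.ball 0 r₀, ENNReal.ofReal (f z) := by
        rw [hI, ← lintegral_inter_add_sdiff _ (Metric.ball 0 R)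
          (Metric.isOpen_ball (x := (0 : ℂ)) (ε := r₀)).measurableSet,
          inter_eq_self_of_subset_right (Metric.ball_subset_ball hrR)]
      calc I ≤ ENNReal.ofReal C₄ * J + (ENNReal.ofReal κ * I +
            ENNReal.ofReal (C₁ * C₂) * (ENNReal.ofReal C₃ * J)) := by
            conv_lhs => rw [hsplit]
            exact add_le_add (hcent V hV.pos hV.le_mul_center h k hh h0 hk) hann
        _ = _ := by
            rw [hM, ENNReal.ofReal_add hC₄.le (by positivity),
              ENNReal.ofReal_mul (p := C₁ * C₂) (by positivity)]
            ring
    -- absorb the term `κ * I`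
    rcases eq_or_ne J ⊤ with hJt | hJt
    · rw [hJt, ENNReal.mul_top]
      · exact le_top
      · simpa using div_pos hM0 (by linarith : 0 < 1 - κ)
    rw [← ENNReal.toReal_le_toReal hIfin (ENNReal.mul_ne_top ENNReal.ofReal_ne_top hJt)]
    have := (ENNReal.toReal_le_toReal hIfin (by finiteness)).2 htot
    rw [ENNReal.toReal_add (by finiteness) (by finiteness), ENNReal.toReal_mul, ENNReal.toReal_mul,
      ENNReal.toReal_ofReal hM0.le, ENNReal.toReal_ofReal hκ0.le] at this
    rw [ENNReal.toReal_mul, ENNReal.toReal_ofReal (div_pos hM0 (by linarith)).le,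
      div_mul_eq_mul_div, le_div_iff₀ (by linarith)]
    linarith
  -- exhaust the disc
  obtain ⟨u, hu, hu1, hulim⟩ := exists_seq_strictMono_tendsto' hr₀
  have hunion : disc = ⋃ n, Metric.ball (0 : ℂ) (u n) := by
    ext z
    simp only [mem_disc, mem_iUnion, mem_ball_zero_iff]
    constructor
    · intro hz
      exact (hulim.eventually (lt_mem_nhds hz)).exists
    · rintro ⟨n, hn⟩
      exact hn.trans (hu1 n).2
  have hdir : Directed (· ⊆ ·) fun n => Metric.ball (0 : ℂ) (u n) :=
    Monotone.directed_le fun a b hab => Metric.ball_subset_ball (hu.monotone hab)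
  rw [hunion, setLIntegral_iUnion_of_directed _ hdir]
  exact iSup_le fun n => hbound (u n) (hu1 n).2 (hu1 n).1.le

end LittlewoodPaley

/-! ### Regularity of the weight -/

section Weight

variable {φ : ℂ → ℝ}

lemma ofReal_mem_disc {r : ℝ} (hr : r ∈ Ioo (-1 : ℝ) 1) : (r : ℂ) ∈ disc := by
  rw [mem_disc, Complex.norm_real, Real.norm_eq_abs, abs_lt]; exact hr

namespace IsSmoothRapidlyDecreasing

lemma contDiffAt (hφ : IsSmoothRapidlyDecreasing φ) {z : ℂ} (hz : z ∈ disc) :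
    ContDiffAt ℝ 2 φ z := hφ.contDiff.contDiffAt (isOpen_disc.mem_nhds hz)

lemma contDiffOn_real (hφ : IsSmoothRapidlyDecreasing φ) :
    ContDiffOn ℝ 2 (fun r : ℝ => φ (r : ℂ)) (Ioo (-1) 1) :=
  hφ.contDiff.comp (Complex.ofRealCLM.contDiff.contDiffOn) fun _ hr => ofReal_mem_disc hr

lemma hasDerivAt_real (hφ : IsSmoothRapidlyDecreasing φ) {r : ℝ} (hr : r ∈ Ioo (-1 : ℝ) 1) :
    HasDerivAt (fun r : ℝ => φ (r : ℂ)) (radialDeriv φ r) r :=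
  ((hφ.contDiffOn_real.differentiableOn two_ne_zero r hr).differentiableAt
    (isOpen_Ioo.mem_nhds hr)).hasDerivAt

lemma differentiableOn_radialDeriv (hφ : IsSmoothRapidlyDecreasing φ) :
    DifferentiableOn ℝ (radialDeriv φ) (Ioo (-1) 1) := by
  have h := hφ.contDiffOn_real
  rw [show (2 : WithTop ℕ∞) = 1 + 1 by norm_num,
    contDiffOn_succ_iff_deriv_of_isOpen isOpen_Ioo] at h
  exact h.2.2.differentiableOn one_ne_zero

lemma Ico_subset : Ico (0 : ℝ) 1 ⊆ Ioo (-1) 1 := fun _ hr => ⟨by linarith [hr.1], hr.2⟩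

lemma radialDeriv_mono (hφ : IsSmoothRapidlyDecreasing φ) :
    MonotoneOn (radialDeriv φ) (Ico 0 1) :=
  hφ.convex.monotoneOn_deriv fun _ hr => (hφ.hasDerivAt_real (Ico_subset hr)).differentiableAt

lemma radialDeriv_nonneg (hφ : IsSmoothRapidlyDecreasing φ) {r : ℝ} (hr : r ∈ Ico (0 : ℝ) 1) :
    0 ≤ radialDeriv φ r := by
  have h := hφ.increasing.derivWithin_nonneg (x := r)
  rwa [((hφ.hasDerivAt_real (Ico_subset hr)).hasDerivWithinAt).derivWithin
    ((uniqueDiffOn_Ico 0 1) r hr)] at h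

lemma eq_norm (hφ : IsSmoothRapidlyDecreasing φ) {z : ℂ} (hz : z ∈ disc) : φ z = φ (‖z‖ : ℝ) := by
  apply hφ.radial _ hz _ (ofReal_mem_disc (Ico_subset (norm_mem_Ico hz)))
  simp

lemma sub_le (hφ : IsSmoothRapidlyDecreasing φ) {a b : ℝ} (ha : a ∈ Ico (0 : ℝ) 1)
    (hb : b ∈ Ico (0 : ℝ) 1) (hab : a ≤ b) :
    radialDeriv φ a * (b - a) ≤ φ (b : ℝ) - φ (a : ℝ) ∧
      φ (b : ℝ) - φ (a : ℝ) ≤ radialDeriv φ b * (b - a) := by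
  rcases hab.eq_or_lt with rfl | hab
  · simp
  have hsub : Icc a b ⊆ Ico 0 1 := fun x hx => ⟨ha.1.trans hx.1, hx.2.trans_lt hb.2⟩
  obtain ⟨x, hx, hx'⟩ := exists_hasDerivAt_eq_slope (fun r : ℝ => φ (r : ℂ)) (radialDeriv φ) hab
    (fun x hx => (hφ.hasDerivAt_real (Ico_subset (hsub hx))).continuousAt.continuousWithinAt)
    (fun x hx => hφ.hasDerivAt_real (Ico_subset (hsub (Ioo_subset_Icc_self hx))))
  have hxI := hsub (Ioo_subset_Icc_self hx)
  have h1 := hφ.radialDeriv_mono ha hxI hx.1.le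
  have h2 := hφ.radialDeriv_mono hxI hb hx.2.le
  have hba : 0 < b - a := sub_pos.2 hab
  rw [eq_div_iff hba.ne'] at hx'
  rw [← hx']
  constructor <;> gcongr

/-- The Laplacian of a radial function in polar coordinates, on the positive axis. -/
lemma laplacian_eq (hφ : IsSmoothRapidlyDecreasing φ) {x : ℝ} (hx : x ∈ Ioo (0 : ℝ) 1) :
    Laplacian.laplacian φ (x : ℂ) = deriv (radialDeriv φ) x + radialDeriv φ x / x := by
  have hx1 : x ∈ Ioo (-1 : ℝ) 1 := ⟨by linarith [hx.1], hx.2⟩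
  have hxd : (x : ℂ) ∈ disc := ofReal_mem_disc hx1
  have hdiff : ∀ z ∈ disc, DifferentiableAt ℝ φ z := fun z hz =>
    (hφ.contDiffAt hz).differentiableAt two_ne_zero
  have hdiff2 : DifferentiableAt ℝ (fderiv ℝ φ) (x : ℂ) :=
    ((hφ.contDiffAt hxd).fderiv_right (m := 1) (by norm_num)).differentiableAt one_ne_zero
  -- derivatives along the line in the direction `v`
  have hline : ∀ (v : ℂ) (t : ℝ), HasDerivAt (fun t : ℝ => (x : ℂ) + t * v) v t := by
    intro v t
    simpa using (Complex.ofRealCLM.hasDerivAt (x := t)).mul_const v |>.const_add (x : ℂ)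
  have hfirst : ∀ v : ℂ, ∀ᶠ t : ℝ in 𝓝 0, HasDerivAt (fun t : ℝ => φ ((x : ℂ) + t * v))
      (fderiv ℝ φ ((x : ℂ) + t * v) v) t := by
    intro v
    have : ∀ᶠ t : ℝ in 𝓝 0, (x : ℂ) + t * v ∈ disc := by
      apply (hline v 0).continuousAt.eventually_mem
      simpa using isOpen_disc.mem_nhds hxd
    filter_upwards [this] with t ht
    exact (hdiff _ ht).hasFDerivAt.comp_hasDerivAt t (hline v t)
  have hsecond : ∀ v : ℂ, HasDerivAt (fun t : ℝ => fderiv ℝ φ ((x : ℂ) + t * v) v)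
      (fderiv ℝ (fderiv ℝ φ) x v v) 0 := by
    intro v
    have h0 : DifferentiableAt ℝ (fderiv ℝ φ) ((x : ℂ) + (0 : ℝ) * v) := by simpa using hdiff2
    have h1 := h0.hasFDerivAt.comp_hasDerivAt (0 : ℝ) (hline v 0)
    have h2 := (ContinuousLinearMap.apply ℝ ℝ v).hasFDerivAt.comp_hasDerivAt (0 : ℝ) h1
    refine HasDerivAt.congr_deriv (f := fun t : ℝ => fderiv ℝ φ ((x : ℂ) + t * v) v) h2 ?_
    simp
  rw [InnerProductSpace.laplacian_eq_iteratedFDeriv_complexPlane]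
  simp only [iteratedFDeriv_two_apply, Matrix.cons_val_zero, Matrix.cons_val_one]
  congr 1
  · have h1 : HasDerivAt (fun t : ℝ => radialDeriv φ (x + t)) (deriv (radialDeriv φ) x) 0 := by
      have h2 : HasDerivAt (radialDeriv φ) (deriv (radialDeriv φ) x) (x + 0) := by
        rw [add_zero]
        exact ((hφ.differentiableOn_radialDeriv x hx1).differentiableAt
          (isOpen_Ioo.mem_nhds hx1)).hasDerivAt
      exact h2.comp_const_add x 0
    refine (hsecond 1).unique (h1.congr_of_eventuallyEq ?_)
    have h3 : ∀ᶠ t : ℝ in 𝓝 0, x + t ∈ Ioo (-1 : ℝ) 1 := by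
      apply (continuous_const.add continuous_id).continuousAt.eventually_mem
      simpa using isOpen_Ioo.mem_nhds hx1
    filter_upwards [hfirst 1, h3] with t ht ht3
    refine ht.unique ?_
    have := (hφ.hasDerivAt_real ht3).comp_const_add x t
    simpa using this
  · -- in the direction `I` the function is `t ↦ φ(√(x² + t²))`
    set s : ℝ → ℝ := fun t => √(x ^ 2 + t ^ 2) with hs
    have hx2 : 0 < x ^ 2 := by have := hx.1; positivity
    have hspos : ∀ t, 0 < s t := fun t => Real.sqrt_pos.2 (by positivity)
    have hsd : ∀ t, HasDerivAt s (t / s t) t := by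
      intro t
      have h1 : HasDerivAt (fun t : ℝ => x ^ 2 + t ^ 2) (2 * t) t := by
        simpa using (hasDerivAt_pow 2 t).const_add (x ^ 2)
      convert h1.sqrt (by positivity) using 1
      simp only [hs]; field_simp
    have hs0 : s 0 = x := by simp [hs, Real.sqrt_sq hx.1.le]
    have hsmem : ∀ᶠ t : ℝ in 𝓝 0, s t ∈ Ioo (-1 : ℝ) 1 := by
      apply (hsd 0).continuousAt.eventually_mem
      rw [hs0]; exact isOpen_Ioo.mem_nhds hx1
    have hnorm : ∀ t : ℝ, ‖(x : ℂ) + t * Complex.I‖ = s t := fun t => by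
      rw [Complex.norm_add_mul_I]
    set G : ℝ → ℝ := fun t => radialDeriv φ (s t) / s t with hG
    have hGd : DifferentiableAt ℝ G 0 := by
      apply DifferentiableAt.div _ (hsd 0).differentiableAt (hspos 0).ne'
      apply DifferentiableAt.comp _ _ (hsd 0).differentiableAt
      rw [hs0]
      exact (hφ.differentiableOn_radialDeriv x hx1).differentiableAt (isOpen_Ioo.mem_nhds hx1)
    have h1 : HasDerivAt (fun t => t * G t) (radialDeriv φ x / x) 0 := by
      have := (hasDerivAt_id (0 : ℝ)).mul hGd.hasDerivAt
      refine HasDerivAt.congr_deriv (f := fun t => t * G t) this ?_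
      simp [hG, hs0]
    refine (hsecond Complex.I).unique (h1.congr_of_eventuallyEq ?_)
    filter_upwards [hfirst Complex.I, hsmem, hsmem.eventually_nhds] with t ht ht2 ht3
    refine ht.unique ?_
    have h2 : HasDerivAt (fun t => φ ((s t : ℝ) : ℂ)) (radialDeriv φ (s t) * (t / s t)) t :=
      (hφ.hasDerivAt_real ht2).comp t (hsd t)
    have h3 : (fun t : ℝ => φ ((x : ℂ) + t * Complex.I)) =ᶠ[𝓝 t] fun t => φ ((s t : ℝ) : ℂ) := by
      filter_upwards [ht3] with u hu
      rw [hφ.eq_norm (mem_disc.2 (by rw [hnorm]; exact hu.2)), hnorm]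
    convert h2.congr_of_eventuallyEq h3 using 1
    simp only [hG]; ring

/-- Since `(r φ')' = r Δφ ≃ r τ⁻²` and `(1/τ)' = -τ'/τ²` with `τ' → 0`, the derivative `φ'` is at
least of the order of `1/τ`. -/
lemma exists_radialDeriv_ge (hφ : IsSmoothRapidlyDecreasing φ) {τ : ℝ → ℝ}
    (hτ : IsAdmissibleScale τ) {C : ℝ} (hC : 0 < C)
    (hle : ∀ z ∈ disc, (Laplacian.laplacian φ z) ^ (-(1 / 2) : ℝ) ≤ C * τ ‖z‖) :
    ∃ r₀ ∈ Ioo (0 : ℝ) 1, (∀ r t, r₀ ≤ r → r ≤ t → t < 1 → τ r - τ t ≤ t - r) ∧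
      ∃ b B : ℝ, 0 < b ∧ 0 < B ∧ ∀ r ∈ Ico r₀ 1, b / τ r - B ≤ radialDeriv φ r := by
  have hev : ∀ᶠ r in 𝓝[<] (1 : ℝ), |deriv τ r| < 1 := by
    have := hτ.tendsto_deriv_zero.abs.eventually (gt_mem_nhds (show |(0 : ℝ)| < 1 by simp))
    exact this
  obtain ⟨r₁, hr₁, hr₁'⟩ := (mem_nhdsLT_iff_exists_Ioo_subset).1
    (hev.and (Ioo_mem_nhdsLT (show (1 / 2 : ℝ) < 1 by norm_num)))
  have hr₁1 : r₁ < 1 := hr₁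
  set r₀ := max r₁ (1 / 2) with hr₀
  have hr₀1 : r₀ < 1 := max_lt hr₁1 (by norm_num)
  have hr₀2 : 1 / 2 ≤ r₀ := le_max_right _ _
  set r₂ := (r₀ + 1) / 2 with hr₂
  have hr₂0 : r₀ < r₂ := by rw [hr₂]; linarith
  have hr₂1 : r₂ < 1 := by rw [hr₂]; linarith
  have hIco : Ico r₂ 1 ⊆ Ioo 0 1 := fun r hr => ⟨by linarith [hr.1], hr.2⟩
  have hτd : ∀ r ∈ Ico r₂ 1, HasDerivAt τ (deriv τ r) r := fun r hr =>
    (((hτ.contDiff.differentiableOn one_ne_zero) r (Ioo_subset_Ico_self (hIco hr))).differentiableAt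
      (Ico_mem_nhds (hIco hr).1 (hIco hr).2)).hasDerivAt
  have hτ1 : ∀ r ∈ Ico r₂ 1, -1 ≤ deriv τ r := fun r hr => by
    have : r ∈ Ioo r₁ 1 := ⟨by linarith [hr.1, le_max_left r₁ (1 / 2)], hr.2⟩
    have h1 := (hr₁' this).1
    linarith [(abs_lt.1 h1).1]
  have hconv : Convex ℝ (Ico r₂ 1) := convex_Ico _ _
  have hint : interior (Ico r₂ 1) ⊆ Ico r₂ 1 := interior_subset
  refine ⟨r₂, ⟨by linarith, hr₂1⟩, ?_, ?_⟩
  · intro r t hr hrt ht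
    have hmono : MonotoneOn (fun x => τ x + x) (Ico r₂ 1) := by
      have hd : ∀ x ∈ Ico r₂ 1, HasDerivAt (fun x => τ x + x) (deriv τ x + 1) x := fun x hx =>
        (hτd x hx).add (hasDerivAt_id x)
      refine monotoneOn_of_deriv_nonneg hconv
        (fun x hx => (hd x hx).continuousAt.continuousWithinAt)
        (fun x hx => (hd x (hint hx)).differentiableAt.differentiableWithinAt) fun x hx => ?_
      rw [(hd x (hint hx)).deriv]
      linarith [hτ1 x (hint hx)]
    have := hmono ⟨hr, hrt.trans_lt ht⟩ ⟨hr.trans hrt, ht⟩ hrt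
    simp only at this
    linarith
  · set b := 1 / (2 * C ^ 2) with hb
    have hb0 : 0 < b := by positivity
    have hτ2 : 0 < τ r₂ := hτ.pos _ (Ioo_subset_Ico_self (hIco ⟨le_rfl, hr₂1⟩))
    refine ⟨b, b / τ r₂, hb0, by positivity, fun r hr => ?_⟩
    have hd : ∀ x ∈ Ico r₂ 1, HasDerivAt (fun x => x * radialDeriv φ x - b / τ x)
        (radialDeriv φ x + x * deriv (radialDeriv φ) x + b * deriv τ x / τ x ^ 2) x := by
      intro x hx
      have hx1 : x ∈ Ioo (-1 : ℝ) 1 := Ico_subset (Ioo_subset_Ico_self (hIco hx))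
      have hτx : τ x ≠ 0 := (hτ.pos _ (Ioo_subset_Ico_self (hIco hx))).ne'
      have h1 : HasDerivAt (radialDeriv φ) (deriv (radialDeriv φ) x) x :=
        ((hφ.differentiableOn_radialDeriv x hx1).differentiableAt
          (isOpen_Ioo.mem_nhds hx1)).hasDerivAt
      have h2 := ((hasDerivAt_id x).mul h1).sub ((hasDerivAt_const x b).div (hτd x hx) hτx)
      refine h2.congr_deriv ?_
      simp only [id]
      field_simp
      ring
    have hmono : MonotoneOn (fun x => x * radialDeriv φ x - b / τ x) (Ico r₂ 1) := by
      refine monotoneOn_of_deriv_nonneg hconv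
        (fun x hx => (hd x hx).continuousAt.continuousWithinAt)
        (fun x hx => (hd x (hint hx)).differentiableAt.differentiableWithinAt) fun x hx => ?_
      have hxI := hint hx
      have hx0 := hIco hxI
      have hxd : (x : ℂ) ∈ disc := ofReal_mem_disc (Ico_subset (Ioo_subset_Ico_self hx0))
      have hτx := hτ.pos _ (Ioo_subset_Ico_self hx0)
      rw [(hd x hxI).deriv]
      have hL := hφ.laplacian_pos _ hxd
      have hlap := hle x hxd
      rw [Complex.norm_real, Real.norm_of_nonneg hx0.1.le] at hlap
      have h3 : 1 / (C * τ x) ^ 2 ≤ Laplacian.laplacian φ (x : ℂ) := by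
        have h4 := Real.rpow_le_rpow_of_nonpos (by positivity) hlap (show (-2 : ℝ) ≤ 0 by norm_num)
        rw [← Real.rpow_mul hL.le, Real.rpow_neg (by positivity), Real.rpow_two] at h4
        norm_num at h4
        simpa using h4
      have h5 : radialDeriv φ x + x * deriv (radialDeriv φ) x =
          x * Laplacian.laplacian φ (x : ℂ) := by
        rw [hφ.laplacian_eq hx0]
        have := hx0.1.ne'
        field_simp; ring
      have h6 : b / τ x ^ 2 ≤ x * Laplacian.laplacian φ (x : ℂ) := by
        calc b / τ x ^ 2 = 1 / 2 * (1 / (C * τ x) ^ 2) := by rw [hb]; field_simp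
          _ ≤ x * Laplacian.laplacian φ (x : ℂ) := by
            have : 1 / 2 ≤ x := by linarith [hxI.1]
            gcongr
      have h7 : -(b / τ x ^ 2) ≤ b * deriv τ x / τ x ^ 2 := by
        rw [← neg_div]
        gcongr
        nlinarith [hτ1 x hxI]
      linarith
    have h8 := hmono ⟨le_rfl, hr₂1⟩ hr hr.1
    simp only at h8
    have hrI := Ioo_subset_Ico_self (hIco hr)
    have h9 := hφ.radialDeriv_nonneg hrI
    have h10 := hφ.radialDeriv_nonneg (Ioo_subset_Ico_self (hIco ⟨le_rfl, hr₂1⟩))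
    have h11 : r * radialDeriv φ r ≤ radialDeriv φ r := mul_le_of_le_one_left h9 hr.2.le
    have h12 : 0 ≤ r₂ * radialDeriv φ r₂ := mul_nonneg (by linarith) h10
    linarith

theorem exists_radialScale (hφ : IsSmoothRapidlyDecreasing φ) :
    ∃ c K : ℝ, c ≤ 1 ∧ RadialScale (fun r => 1 + radialDeriv φ r) c K ∧
      ∀ M : ℝ, ∃ r₀ < 1, ∀ r ∈ Ico r₀ 1, M ≤ radialDeriv φ r := by
  obtain ⟨τ, hτ, ⟨_, C, -, hC, hle⟩, η, hη, K₀, hK₀, hdec⟩ := hφ.exists_scale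
  obtain ⟨r₀, hr₀, hlip, b, B, hb, hB, hge⟩ :=
    hφ.exists_radialDeriv_ge hτ hC fun z hz => (hle z hz).2
  have hIco : Ico r₀ 1 ⊆ Ico 0 1 := fun r hr => ⟨hr₀.1.le.trans hr.1, hr.2⟩
  have hτr : ∀ r ∈ Ico r₀ 1, τ r ≤ 1 - r := by
    intro r hr
    have h1 : Tendsto (fun t => τ t + (t - r)) (𝓝[<] 1) (𝓝 (0 + (1 - r))) := by
      apply hτ.tendsto_zero.add
      exact ((continuous_id.sub continuous_const).tendsto' _ _ rfl).mono_left nhdsWithin_le_nhds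
    rw [zero_add] at h1
    refine ge_of_tendsto h1 ?_
    filter_upwards [Ioo_mem_nhdsLT hr.2] with t ht
    linarith [hlip r t hr.1 ht.1.le ht.2]
  set lam : ℝ → ℝ := fun r => 1 + radialDeriv φ r with hlam
  have hone : ∀ r ∈ Ico (0 : ℝ) 1, 1 ≤ lam r := fun r hr => by
    have := hφ.radialDeriv_nonneg hr
    simp only [hlam]; linarith
  have hmono : MonotoneOn lam (Ico 0 1) := fun x hx y hy hxy => by
    have := hφ.radialDeriv_mono hx hy hxy
    simp only [hlam]; linarith
  set a := b / (1 + B) with ha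
  have ha0 : 0 < a := by positivity
  have hlower : ∀ r ∈ Ico r₀ 1, a / τ r ≤ lam r := by
    intro r hr
    have h1 := hge r hr
    have h2 := hφ.radialDeriv_nonneg (hIco hr)
    have h3 : a / τ r = (b / τ r) / (1 + B) := by rw [ha]; ring
    rw [h3, div_le_iff₀ (by positivity)]
    simp only [hlam]
    nlinarith
  set c := min (a / 2) ((1 - r₀) / 2) with hc
  have hc0 : 0 < c := lt_min (by positivity) (by linarith [hr₀.2])
  have hc1 : c ≤ a / 2 := min_le_left _ _
  have hc2 : c ≤ (1 - r₀) / 2 := min_le_right _ _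
  set r₃ := (1 + r₀) / 2 with hr₃
  have hr₃I : r₃ ∈ Ico (0 : ℝ) 1 := ⟨by rw [hr₃]; linarith [hr₀.1], by rw [hr₃]; linarith [hr₀.2]⟩
  have hsmall : ∀ r ∈ Ico (0 : ℝ) 1, r < r₀ → r + c / lam r ≤ r₃ := by
    intro r hr hrr
    have : c / lam r ≤ c := div_le_self hc0.le (hone r hr)
    rw [hr₃]; linarith
  have hlarge : ∀ r ∈ Ico r₀ 1, c / lam r ≤ τ r / 2 := by
    intro r hr
    have hτp := hτ.pos r (hIco hr)
    have h1 := hlower r hr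
    have h2 : 0 < lam r := zero_lt_one.trans_le (hone r (hIco hr))
    rw [div_le_iff₀ h2]
    rw [div_le_iff₀ hτp] at h1
    linarith
  have hstep : ∀ r ∈ Ico (0 : ℝ) 1, r + c / lam r < 1 := by
    intro r hr
    rcases lt_or_ge r r₀ with h | h
    · exact (hsmall r hr h).trans_lt hr₃I.2
    · have h1 := hlarge r ⟨h, hr.2⟩
      have h2 := hτr r ⟨h, hr.2⟩
      have h3 := hr.2
      linarith
  refine ⟨c, lam r₃ + K₀ * 2 ^ η, ?_, ⟨?_, hone, hmono, ?_, hc0, hstep, ?_⟩, ?_⟩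
  · linarith [hr₀.1]
  · exact measurable_const.add (measurable_deriv _)
  · exact ((hφ.differentiableOn_radialDeriv.mono
      (Ioo_subset_Ico_self.trans Ico_subset)).const_add 1)
  · intro r hr
    have hl := zero_lt_one.trans_le (hone r hr)
    have hl₃ := zero_lt_one.trans_le (hone r₃ hr₃I)
    have hmem : r + c / lam r ∈ Ico (0 : ℝ) 1 := ⟨by have := hr.1; positivity, hstep r hr⟩
    have h2η : 0 < (2 : ℝ) ^ η := by positivity
    rcases lt_or_ge r r₀ with h | h
    · calc lam (r + c / lam r) ≤ lam r₃ := hmono hmem hr₃I (hsmall r hr h)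
        _ ≤ lam r₃ * lam r := le_mul_of_one_le_right hl₃.le (hone r hr)
        _ ≤ _ := by gcongr; exact le_add_of_nonneg_right (by positivity)
    · have hrI : r ∈ Ico r₀ 1 := ⟨h, hr.2⟩
      have hτp := hτ.pos r hr
      have hcl : 0 ≤ c / lam r := by positivity
      have h1 := hlip r (r + c / lam r) h (by linarith) hmem.2
      have h2 := hlarge r hrI
      have h3 : τ r / 2 ≤ τ (r + c / lam r) := by linarith
      have h4 := hdec r (r + c / lam r) hr.1 (by linarith) hmem.2
      have h5 : (τ r / 2) ^ η ≤ τ (r + c / lam r) ^ η := by gcongr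
      rw [Real.div_rpow hτp.le zero_le_two, div_le_iff₀ h2η] at h5
      have hlm := zero_lt_one.trans_le (hone _ hmem)
      have hτη : 0 < τ r ^ η := by positivity
      have h6 : lam (r + c / lam r) * τ r ^ η ≤ (K₀ * 2 ^ η * lam r) * τ r ^ η := by
        calc lam (r + c / lam r) * τ r ^ η
            ≤ lam (r + c / lam r) * (τ (r + c / lam r) ^ η * 2 ^ η) := by gcongr
          _ = (lam (r + c / lam r) * τ (r + c / lam r) ^ η) * 2 ^ η := by ring
          _ ≤ (K₀ * (lam r * τ r ^ η)) * 2 ^ η := by gcongr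
          _ = _ := by ring
      calc lam (r + c / lam r) ≤ K₀ * 2 ^ η * lam r := le_of_mul_le_mul_right h6 hτη
        _ ≤ _ := by gcongr; exact le_add_of_nonneg_left hl₃.le
  · intro M
    have h1 : Tendsto (fun r => b / τ r - B) (𝓝[<] 1) atTop := by
      apply tendsto_atTop_add_const_right
      apply Tendsto.const_mul_atTop hb
      apply tendsto_inv_nhdsGT_zero.comp
      rw [tendsto_nhdsWithin_iff]
      refine ⟨hτ.tendsto_zero, ?_⟩
      filter_upwards [Ioo_mem_nhdsLT zero_lt_one] with r hr using hτ.pos r (Ioo_subset_Ico_self hr)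
    obtain ⟨r₁, hr₁, h2⟩ := mem_nhdsLT_iff_exists_Ioo_subset.1
      ((h1.eventually_ge_atTop M).and (Ioo_mem_nhdsLT hr₀.2))
    have hr₁' : r₁ < 1 := hr₁
    refine ⟨(r₁ + 1) / 2, by linarith, fun r hr => ?_⟩
    have h3 := h2 ⟨by linarith [hr.1], hr.2⟩
    exact h3.1.trans (hge r ⟨h3.2.1.le, hr.2⟩)

end IsSmoothRapidlyDecreasing

end Weight

/-! ### The symbol -/

lemma sub_le_of_gradNorm_le {ψ : ℂ → ℝ} {x y : ℂ} {L : ℝ} (hψ : ContinuousOn ψ (segment ℝ x y))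
    (hL : 0 ≤ L) (h : ∀ z ∈ segment ℝ x y, gradNorm ψ z ≤ ENNReal.ofReal L) :
    ψ y - ψ x ≤ L * ‖y - x‖ := by
  rcases eq_or_ne x y with rfl | hxy
  · simp
  have hd : 0 < ‖y - x‖ := norm_pos_iff.2 (sub_ne_zero.2 hxy.symm)
  set γ : ℝ → ℂ := fun t => x + t * (y - x) with hγ
  have hγc : Continuous γ := by fun_prop
  have hγm : ∀ t ∈ Icc (0 : ℝ) 1, γ t ∈ segment ℝ x y := fun t ht => by
    rw [segment_eq_image']
    exact ⟨t, ht, by simp [hγ]⟩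
  have hγs : ∀ t u, ‖γ u - γ t‖ = |u - t| * ‖y - x‖ := fun t u => by
    rw [show γ u - γ t = ((u - t : ℝ) : ℂ) * (y - x) by simp only [hγ]; push_cast; ring, norm_mul,
      Complex.norm_real, Real.norm_eq_abs]
  have key := image_le_of_liminf_slope_right_le_deriv_boundary (f := fun t => ψ (γ t)) (a := 0)
    (b := 1) (B := fun t => ψ x + t * (L * ‖y - x‖)) (B' := fun _ => L * ‖y - x‖)
    (hψ.comp hγc.continuousOn hγm) (by simp [hγ]) (by fun_prop)
    (fun t _ => by
      simpa using ((hasDerivAt_id t).mul_const (L * ‖y - x‖)).const_add (ψ x) |>.hasDerivWithinAt)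
    (fun t ht r hr => ?_) (right_mem_Icc.2 zero_le_one)
  · simp [hγ] at key; linarith
  · have hr' : L < r / ‖y - x‖ := by rwa [lt_div_iff₀ hd]
    have h1 : gradNorm ψ (γ t) < ENNReal.ofReal (r / ‖y - x‖) :=
      (h _ (hγm t (Ico_subset_Icc_self ht))).trans_lt
        ((ENNReal.ofReal_lt_ofReal_iff (hL.trans_lt hr')).2 hr')
    have h2 := eventually_lt_of_limsup_lt h1
    have h3 : Tendsto γ (𝓝[>] t) (𝓝[≠] (γ t)) := by
      rw [tendsto_nhdsWithin_iff]
      refine ⟨hγc.continuousAt.mono_left nhdsWithin_le_nhds, ?_⟩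
      filter_upwards [self_mem_nhdsWithin] with u (hu : t < u)
      have : 0 < ‖γ u - γ t‖ := by
        rw [hγs]
        exact mul_pos (abs_pos.2 (sub_pos.2 hu).ne') hd
      exact sub_ne_zero.1 (norm_pos_iff.1 this)
    apply Eventually.frequently
    filter_upwards [h3.eventually h2, self_mem_nhdsWithin] with u hu (htu : t < u)
    have hpos : 0 < u - t := sub_pos.2 htu
    rw [ENNReal.ofReal_lt_ofReal_iff (hL.trans_lt hr'), hγs, abs_of_pos hpos] at hu
    rw [slope_def_field, div_lt_iff₀ hpos]
    rw [div_lt_div_iff₀ (by positivity) hd] at hu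
    have h4 : |ψ (γ u) - ψ (γ t)| < r * (u - t) := by
      have : |ψ (γ u) - ψ (γ t)| * ‖y - x‖ < r * (u - t) * ‖y - x‖ := by linarith
      exact lt_of_mul_lt_mul_right this hd.le
    exact (le_abs_self _).trans_lt h4

lemma abs_sub_le_of_gradNorm_le {ψ : ℂ → ℝ} {x y : ℂ} {L : ℝ}
    (hψ : ContinuousOn ψ (segment ℝ x y)) (hL : 0 ≤ L)
    (h : ∀ z ∈ segment ℝ x y, gradNorm ψ z ≤ ENNReal.ofReal L) :
    |ψ y - ψ x| ≤ L * ‖y - x‖ := by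
  rw [abs_sub_le_iff]
  refine ⟨sub_le_of_gradNorm_le hψ hL h, ?_⟩
  rw [norm_sub_rev]
  rw [segment_symm] at hψ h
  exact sub_le_of_gradNorm_le hψ hL h

/-- The reverse inequality `|∇|g|^s| ≥ s |g|^(s-1) |g'|` is seen along the direction in which `|g|`
grows fastest. -/
lemma le_gradNorm_rpow {g : ℂ → ℂ} {g' z : ℂ} (hg : HasDerivAt g g' z) (h0 : g z ≠ 0) (s : ℝ)
    (hs : 0 ≤ s) :
    ENNReal.ofReal (s * ‖g z‖ ^ (s - 1) * ‖g'‖) ≤ gradNorm (fun w => ‖g w‖ ^ s) z := by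
  rcases eq_or_ne g' 0 with rfl | hg'
  · simp
  have hn : 0 < ‖g z‖ := norm_pos_iff.2 h0
  have hn' : 0 < ‖g'‖ := norm_pos_iff.2 hg'
  set ζ : ℂ := ((‖g'‖ / ‖g z‖ : ℝ) : ℂ) * g z / g' with hζ
  have hζ1 : ‖ζ‖ = 1 := by
    rw [hζ, norm_div, norm_mul, Complex.norm_real, Real.norm_of_nonneg (by positivity)]
    field_simp
  set γ : ℝ → ℂ := fun t => z + t * ζ with hγ
  have hγ0 : γ 0 = z := by simp [hγ]
  have hγd : HasDerivAt γ ζ 0 := by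
    refine HasDerivAt.congr_deriv (f := γ)
      (((Complex.ofRealCLM.hasDerivAt (x := (0 : ℝ))).mul_const ζ).const_add z) ?_
    simp
  have hγn : ∀ t, ‖γ t - z‖ = |t| := fun t => by simp [hγ, hζ1]
  have h1 : HasDerivAt (fun t => g (γ t)) (((‖g'‖ / ‖g z‖ : ℝ) : ℂ) * g z) 0 := by
    have : HasDerivAt g g' (γ 0) := by rwa [hγ0]
    refine (this.comp (0 : ℝ) hγd).congr_deriv ?_
    rw [hζ]; field_simp
  have h2 : HasDerivAt (fun t => ‖g (γ t)‖ ^ s) (s * ‖g z‖ ^ (s - 1) * ‖g'‖) 0 := by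
    have h3 := h1.norm_sq.rpow_const (p := s / 2) (Or.inl (by rw [hγ0]; positivity))
    have e : (fun t => (‖g (γ t)‖ ^ 2) ^ (s / 2)) = fun t => ‖g (γ t)‖ ^ s := by
      funext t
      rw [← Real.rpow_natCast, ← Real.rpow_mul (norm_nonneg _)]
      congr 1; push_cast; ring
    rw [e] at h3
    refine h3.congr_deriv ?_
    rw [hγ0, ← Complex.real_smul, real_inner_smul_right, real_inner_self_eq_norm_sq,
      ← Real.rpow_natCast ‖g z‖, ← Real.rpow_mul hn.le,
      show ((2 : ℕ) : ℝ) * (s / 2 - 1) = (s - 1) - 1 by push_cast; ring,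
      Real.rpow_sub_one hn.ne' (s - 1)]
    push_cast
    rw [Real.rpow_two]
    field_simp
  have h4 : Tendsto γ (𝓝[>] 0) (𝓝[≠] z) := by
    rw [tendsto_nhdsWithin_iff]
    refine ⟨?_, ?_⟩
    · have := hγd.continuousAt.tendsto
      rw [hγ0] at this
      exact this.mono_left nhdsWithin_le_nhds
    · filter_upwards [self_mem_nhdsWithin] with t (ht : 0 < t)
      have : 0 < ‖γ t - z‖ := by rw [hγn]; positivity
      exact sub_ne_zero.1 (norm_pos_iff.1 this)
  have h5 : Tendsto (fun t => ENNReal.ofReal (|‖g (γ t)‖ ^ s - ‖g z‖ ^ s| / ‖γ t - z‖)) (𝓝[>] 0)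
      (𝓝 (ENNReal.ofReal (s * ‖g z‖ ^ (s - 1) * ‖g'‖))) := by
    apply ENNReal.tendsto_ofReal
    have h6 := (h2.tendsto_slope.mono_left
      (nhdsWithin_mono 0 fun t (ht : 0 < t) => ht.ne')).abs
    rw [abs_of_nonneg (by positivity)] at h6
    refine h6.congr' ?_
    filter_upwards [self_mem_nhdsWithin] with t (ht : 0 < t)
    rw [slope_def_field, abs_div, hγ0, sub_zero, hγn]
  rw [← h5.limsup_eq]
  have h7 := limsup_comp (fun w => ENNReal.ofReal (|‖g w‖ ^ s - ‖g z‖ ^ s| / ‖w - z‖)) γ (𝓝[>] 0)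
  refine (le_of_eq h7).trans ?_
  exact limsup_le_limsup_of_le h4

/-- The Bloch-type condition `|∇|g|^s| ≤ B λ` on the disc. -/
structure IsBlochSymbol (lam : ℝ → ℝ) (s B : ℝ) (g : ℂ → ℂ) : Prop where
  analytic : AnalyticOnDisc g
  pos : 0 < B
  gradNorm_le : ∀ z ∈ disc, gradNorm (fun w => ‖g w‖ ^ s) z ≤ ENNReal.ofReal (B * lam ‖z‖)

/-- The regularization `|g|^s + Λ B` of `|g|^s`; unlike `|g|^s` it varies slowly, and the more so
the larger `Λ` is. -/
noncomputable def regularized (s Λ B : ℝ) (g : ℂ → ℂ) (z : ℂ) : ℝ := ‖g z‖ ^ s + Λ * B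

section Symbol

variable {lam : ℝ → ℝ} {c K s B Λ : ℝ} {g : ℂ → ℂ}

lemma IsBlochSymbol.abs_sub_le (hg : IsBlochSymbol lam s B g) (hl : RadialScale lam c K)
    (hs : 0 ≤ s) {R : ℝ} (hR : R ∈ Ico (0 : ℝ) 1) {z w : ℂ} (hz : ‖z‖ ≤ R) (hw : ‖w‖ ≤ R) :
    |‖g z‖ ^ s - ‖g w‖ ^ s| ≤ B * lam R * ‖z - w‖ := by
  have hsub : segment ℝ w z ⊆ Metric.closedBall 0 R :=
    (convex_closedBall (0 : ℂ) R).segment_subset (by simpa using hw) (by simpa using hz)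
  have hsub' : segment ℝ w z ⊆ disc := hsub.trans (Metric.closedBall_subset_ball hR.2)
  have hlR := hl.pos hR
  have hB := hg.pos
  refine abs_sub_le_of_gradNorm_le (ψ := fun w => ‖g w‖ ^ s) ?_ (by positivity) fun x hx => ?_
  · exact (hg.analytic.continuousOn.mono hsub').norm.rpow_const fun _ _ => Or.inr hs
  · refine (hg.gradNorm_le x (hsub' hx)).trans (ENNReal.ofReal_le_ofReal ?_)
    gcongr
    exact hl.mono (norm_mem_Ico (hsub' hx)) hR (by simpa using hsub hx)

lemma regularized_pos (hB : 0 < B) (hΛ : 1 ≤ Λ) (z : ℂ) : 0 < regularized s Λ B g z := by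
  have : 0 < Λ * B := by positivity
  unfold regularized; positivity

lemma IsBlochSymbol.regularized_le (hg : IsBlochSymbol lam s B g) (hl : RadialScale lam c K)
    (hs : 0 ≤ s) (hΛ : 1 ≤ Λ) {R : ℝ} (hR : R ∈ Ico (0 : ℝ) 1) {z w : ℂ} (hz : ‖z‖ ≤ R)
    (hw : ‖w‖ ≤ R) :
    regularized s Λ B g z ≤ (1 + lam R * ‖z - w‖ / Λ) * regularized s Λ B g w := by
  have h := (le_abs_self _).trans (hg.abs_sub_le hl hs hR hz hw)
  have hB := hg.pos
  have hlR := hl.pos hR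
  have h1 : B * lam R * ‖z - w‖ = lam R * ‖z - w‖ / Λ * (Λ * B) := by field_simp
  have h2 : lam R * ‖z - w‖ / Λ * (Λ * B) ≤ lam R * ‖z - w‖ / Λ * regularized s Λ B g w := by
    gcongr
    unfold regularized
    exact le_add_of_nonneg_left (by positivity)
  unfold regularized at *
  linarith

/-- The growth estimate for `g'`. Where `|g|^s ≥ B` it is the Bloch condition itself; elsewhere
`|g|^s` is at most a multiple of `B` in a disc of radius comparable to `1 / λ`, and Cauchy's
estimate applies. -/
lemma exists_regularized_mul_deriv_le (hl : RadialScale lam c K) (hs : 1 ≤ s) (hΛ : 1 ≤ Λ) :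
    ∃ C : ℝ, 0 < C ∧ ∀ (B : ℝ) (g : ℂ → ℂ), IsBlochSymbol lam s B g → ∀ z ∈ disc,
      regularized s Λ B g z ^ ((s - 1) / s) * ‖deriv g z‖ ≤ C * B * lam ‖z‖ := by
  have hc := hl.c_pos
  have hK : 0 < K := zero_lt_one.trans_le hl.one_le_const
  have hs0 : 0 < s := by linarith
  have hα : 0 ≤ (s - 1) / s := div_nonneg (by linarith) hs0.le
  set C₁ := (1 + Λ) ^ ((s - 1) / s) with hC₁
  have hC₁0 : 0 < C₁ := by positivity
  set C₂ := C₁ * ((1 + K * c) ^ (1 / s) * (2 / c)) with hC₂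
  have hC₂0 : 0 < C₂ := by positivity
  refine ⟨C₁ + C₂, by positivity, fun B g hg z hz => ?_⟩
  have hB := hg.pos
  have hz' := norm_mem_Ico hz
  have hlz := hl.pos hz'
  rcases lt_or_ge (‖g z‖ ^ s) B with h | h
  · have hΓ : regularized s Λ B g z ^ ((s - 1) / s) ≤ C₁ * B ^ ((s - 1) / s) := by
      rw [hC₁, ← Real.mul_rpow (by positivity) hB.le]
      have h1 : 0 ≤ regularized s Λ B g z := (regularized_pos hB hΛ z).le
      gcongr
      unfold regularized; linarith
    set ρ := c / lam ‖z‖ with hρ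
    have hρ0 : 0 < ρ := by positivity
    have hR := hl.step_mem hz'
    have hsphere : ∀ w ∈ Metric.sphere z (ρ / 2), ‖g w‖ ≤ ((1 + K * c) * B) ^ (1 / s) := by
      intro w hw
      have hwz : ‖w - z‖ = ρ / 2 := by simpa [dist_eq_norm] using hw
      have hwR : ‖w‖ ≤ ‖z‖ + ρ := by
        have := norm_sub_norm_le w z; linarith
      have h1 := (le_abs_self _).trans
        (hg.abs_sub_le hl hs0.le hR hwR (le_add_of_nonneg_right hρ0.le))
      have h2 : B * lam (‖z‖ + ρ) * ‖w - z‖ ≤ B * (K * lam ‖z‖) * ρ := by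
        rw [hwz]
        gcongr
        · exact hl.doubling _ hz'
        · linarith
      have h3 : B * (K * lam ‖z‖) * ρ = K * c * B := by rw [hρ]; field_simp
      have h4 : ‖g w‖ ^ s ≤ (1 + K * c) * B := by linarith
      calc ‖g w‖ = (‖g w‖ ^ s) ^ (1 / s) := by
            rw [← Real.rpow_mul (norm_nonneg _), mul_one_div_cancel hs0.ne', Real.rpow_one]
        _ ≤ _ := by gcongr
    have hdiff : DiffContOnCl ℂ g (Metric.ball z (ρ / 2)) := by
      apply DifferentiableOn.diffContOnCl
      refine hg.analytic.mono (Metric.closure_ball_subset_closedBall.trans fun w hw => ?_)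
      refine (hl.near hz ?_).1
      have : ‖w - z‖ ≤ ρ / 2 := by simpa [dist_eq_norm] using hw
      linarith
    have hder := Complex.norm_deriv_le_of_forall_mem_sphere_norm_le (by positivity) hdiff hsphere
    calc _ ≤ C₁ * B ^ ((s - 1) / s) * (((1 + K * c) * B) ^ (1 / s) / (ρ / 2)) := by gcongr
      _ = C₂ * (B ^ ((s - 1) / s) * B ^ (1 / s)) * lam ‖z‖ := by
          rw [Real.mul_rpow (by positivity) hB.le, hρ, hC₂]; field_simp
      _ = C₂ * B * lam ‖z‖ := by
          rw [← Real.rpow_add hB, ← add_div, sub_add_cancel, div_self hs0.ne', Real.rpow_one]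
      _ ≤ _ := by gcongr; exact le_add_of_nonneg_left hC₁0.le
  · have hn : 0 < ‖g z‖ := by
      rcases (norm_nonneg (g z)).eq_or_lt with h0 | h0
      · rw [← h0, Real.zero_rpow hs0.ne'] at h; exact absurd h (not_le.2 hB)
      · exact h0
    have hΓ : regularized s Λ B g z ^ ((s - 1) / s) ≤ C₁ * ‖g z‖ ^ (s - 1) := by
      have h1 : 0 ≤ regularized s Λ B g z := (regularized_pos hB hΛ z).le
      calc _ ≤ ((1 + Λ) * ‖g z‖ ^ s) ^ ((s - 1) / s) := by
            gcongr
            unfold regularized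
            nlinarith
        _ = _ := by
            rw [Real.mul_rpow (by positivity) (by positivity), ← Real.rpow_mul hn.le,
              mul_div_cancel₀ _ hs0.ne']
    have hd : HasDerivAt g (deriv g z) z :=
      (hg.analytic.differentiableAt (isOpen_disc.mem_nhds hz)).hasDerivAt
    have h2 := (le_gradNorm_rpow hd (norm_pos_iff.1 hn) s hs0.le).trans (hg.gradNorm_le z hz)
    rw [ENNReal.ofReal_le_ofReal_iff (by positivity)] at h2
    have h3 : ‖g z‖ ^ (s - 1) * ‖deriv g z‖ ≤ B * lam ‖z‖ := by
      refine le_trans ?_ h2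
      rw [mul_assoc]
      exact le_mul_of_one_le_left (by positivity) hs
    calc _ ≤ C₁ * ‖g z‖ ^ (s - 1) * ‖deriv g z‖ := by gcongr
      _ = C₁ * (‖g z‖ ^ (s - 1) * ‖deriv g z‖) := by ring
      _ ≤ C₁ * (B * lam ‖z‖) := by gcongr
      _ = C₁ * B * lam ‖z‖ := by ring
      _ ≤ _ := by gcongr; exact le_add_of_nonneg_right hC₂0.le

end Symbol

section ShiftDecay

variable {φ : ℂ → ℝ} {c K p s : ℝ}

namespace IsSmoothRapidlyDecreasing

lemma sub_le_mul_norm_sub (hφ : IsSmoothRapidlyDecreasing φ) {R : ℝ} (hR : R ∈ Ico (0 : ℝ) 1)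
    {z w : ℂ} (hz : ‖z‖ ≤ R) (hw : ‖w‖ ≤ R) :
    φ w - φ z ≤ (1 + radialDeriv φ R) * ‖z - w‖ := by
  have hzd : z ∈ disc := mem_disc.2 (hz.trans_lt hR.2)
  have hwd : w ∈ disc := mem_disc.2 (hw.trans_lt hR.2)
  have hR0 := hφ.radialDeriv_nonneg hR
  rw [hφ.eq_norm hzd, hφ.eq_norm hwd]
  rcases le_total ‖z‖ ‖w‖ with h | h
  · refine ((hφ.sub_le (norm_mem_Ico hzd) (norm_mem_Ico hwd) h).2).trans ?_
    have h1 := hφ.radialDeriv_mono (norm_mem_Ico hwd) hR hw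
    have h2 := norm_sub_norm_le w z
    rw [norm_sub_rev] at h2
    exact mul_le_mul (by linarith) h2 (sub_nonneg.2 h) (by linarith)
  · have := hφ.increasing (norm_mem_Ico hwd) (norm_mem_Ico hzd) h
    simp only at this
    have : 0 ≤ (1 + radialDeriv φ R) * ‖z - w‖ := by positivity
    linarith

/-- Near the unit circle the radial shift decreases `φ` by at least a fixed amount, while the
relative size of the shift tends to `0`. -/
lemma exists_shift_drop (hφ : IsSmoothRapidlyDecreasing φ) (hc1 : c ≤ 1)
    (hl : RadialScale (fun r => 1 + radialDeriv φ r) c K)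
    (hlim : ∀ M : ℝ, ∃ r₀ < 1, ∀ r ∈ Ico r₀ 1, M ≤ radialDeriv φ r) :
    ∃ κ : ℝ, 0 < κ ∧ ∀ q < 1, ∃ r₀ < 1, 3 / 4 ≤ r₀ ∧ ∀ z ∈ disc, r₀ ≤ ‖z‖ →
      κ ≤ φ z - φ (shiftPoint (fun r => 1 + radialDeriv φ r) c z) ∧
      q ≤ shift (fun r => 1 + radialDeriv φ r) c ‖z‖ / ‖z‖ := by
  have hc := hl.c_pos
  have hK : 0 < K := zero_lt_one.trans_le hl.one_le_const
  refine ⟨c / (4 * K), by positivity, fun q hq1 => ?_⟩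
  have hq1' : 0 < 1 - q := by linarith
  have hinv : 0 < 1 / (1 - q) := by positivity
  obtain ⟨r', hr', hbig⟩ := hlim (2 * K + 1 / (1 - q))
  refine ⟨max r' (3 / 4), max_lt hr' (by norm_num), le_max_right _ _, fun z hz hrz => ?_⟩
  have hrz1 : r' ≤ ‖z‖ := (le_max_left _ _).trans hrz
  have hrz2 : 3 / 4 ≤ ‖z‖ := (le_max_right _ _).trans hrz
  have hz' := norm_mem_Ico hz
  have hn : 0 < ‖z‖ := by linarith
  have hlz := hl.pos hz'
  obtain ⟨e1, e2, e3⟩ := hl.norm_shiftPoint_sub hz (by linarith)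
  have hlbig := hbig ‖z‖ ⟨hrz1, hz'.2⟩
  constructor
  · set y := shiftPoint (fun r => 1 + radialDeriv φ r) c z with hy
    have hyn := norm_mem_Ico e2
    have hly := hl.pos hyn
    have hyz : ‖y‖ ≤ ‖z‖ := by rw [e3]; exact (hl.shift_lt hz').le
    obtain ⟨-, -, hnear⟩ := hl.near hz (w := y) (by
      rw [e1]; exact half_lt_self (by positivity))
    rw [hφ.eq_norm hz, hφ.eq_norm e2]
    refine le_trans ?_ (hφ.sub_le hyn hz' hyz).1
    have h1 : ‖z‖ - ‖y‖ = c / (2 * (1 + radialDeriv φ ‖z‖)) := by rw [e3, shift]; ring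
    have h2 : 2 ≤ 1 + radialDeriv φ ‖y‖ := by
      by_contra! h
      nlinarith
    have h3 : (1 + radialDeriv φ ‖y‖) / 2 ≤ radialDeriv φ ‖y‖ := by linarith
    have h4 := hφ.radialDeriv_nonneg hyn
    rw [h1]
    calc c / (4 * K) = ((1 + radialDeriv φ ‖y‖) / 2) *
          (c / (2 * (K * (1 + radialDeriv φ ‖y‖)))) := by field_simp; norm_num
      _ ≤ radialDeriv φ ‖y‖ * (c / (2 * (1 + radialDeriv φ ‖z‖))) := by gcongr
  · rw [le_div_iff₀ hn, shift]
    have h2 : c / (2 * (1 + radialDeriv φ ‖z‖)) ≤ (1 - q) / 2 := by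
      rw [div_le_div_iff₀ (by positivity) two_pos]
      have h3 : 1 ≤ (1 - q) * (1 + radialDeriv φ ‖z‖) := by
        have : 1 / (1 - q) ≤ 1 + radialDeriv φ ‖z‖ := by linarith
        rw [div_le_iff₀ hq1'] at this
        linarith
      linarith
    nlinarith

end IsSmoothRapidlyDecreasing

variable {B Λ : ℝ} {g : ℂ → ℂ}

lemma regularized_weight_le (hφ : IsSmoothRapidlyDecreasing φ)
    (hl : RadialScale (fun r => 1 + radialDeriv φ r) c K)
    (hg : IsBlochSymbol (fun r => 1 + radialDeriv φ r) s B g) (hp : 0 < p) (hs : 0 ≤ s)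
    (hΛ : 1 ≤ Λ) {a N : ℝ} (ha : 0 ≤ a) (haN : a ≤ N) {R : ℝ} (hR : R ∈ Ico (0 : ℝ) 1) {z w : ℂ}
    (hz : ‖z‖ ≤ R) (hw : ‖w‖ ≤ R) {d : ℝ} (hd : (1 + radialDeriv φ R) * ‖z - w‖ ≤ d) :
    regularized s Λ B g z ^ a * Real.exp (-p * φ z) ≤
      (1 + d) ^ N * Real.exp (p * d) * (regularized s Λ B g w ^ a * Real.exp (-p * φ w)) := by
  have hlR := hl.pos hR
  have hd0 : 0 ≤ d := le_trans (by positivity) hd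
  have hz0 := regularized_pos (s := s) (g := g) hg.pos hΛ z
  have hw0 := regularized_pos (s := s) (g := g) hg.pos hΛ w
  have h1 := hg.regularized_le hl hs hΛ hR hz hw
  have h2 : regularized s Λ B g z ≤ (1 + d) * regularized s Λ B g w := by
    refine h1.trans ?_
    gcongr
    exact (div_le_self (by positivity) hΛ).trans hd
  have h3 : regularized s Λ B g z ^ a ≤ (1 + d) ^ N * regularized s Λ B g w ^ a := by
    calc _ ≤ ((1 + d) * regularized s Λ B g w) ^ a := by gcongr
      _ = (1 + d) ^ a * regularized s Λ B g w ^ a := Real.mul_rpow (by positivity) hw0.le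
      _ ≤ _ := by
          gcongr
          linarith
  have h4 : Real.exp (-p * φ z) ≤ Real.exp (p * d) * Real.exp (-p * φ w) := by
    rw [← Real.exp_add]
    gcongr
    nlinarith [hφ.sub_le_mul_norm_sub hR hz hw]
  calc _ ≤ ((1 + d) ^ N * regularized s Λ B g w ^ a) *
        (Real.exp (p * d) * Real.exp (-p * φ w)) := by gcongr
    _ = _ := by ring

lemma IsBlochSymbol.regularized_rpow_le_shift {lam : ℝ → ℝ} (hg : IsBlochSymbol lam s B g)
    (hl : RadialScale lam c K) (hs : 0 ≤ s) (hΛ : 1 ≤ Λ) {a : ℝ} (ha : 0 ≤ a) {z : ℂ}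
    (hz : z ∈ disc) (hcz : c / 2 < ‖z‖) :
    regularized s Λ B g z ^ a ≤
      Real.exp (c / (2 * Λ) * a) * regularized s Λ B g (shiftPoint lam c z) ^ a := by
  have hc := hl.c_pos
  have hz' := norm_mem_Ico hz
  have hlz := hl.pos hz'
  obtain ⟨e1, e2, e3⟩ := hl.norm_shiftPoint_sub hz hcz
  have hyz : ‖shiftPoint lam c z‖ ≤ ‖z‖ := by rw [e3]; exact (hl.shift_lt hz').le
  have hz0 := regularized_pos (s := s) (g := g) hg.pos hΛ z
  have hy0 := regularized_pos (s := s) (g := g) hg.pos hΛ (shiftPoint lam c z)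
  have h1 := hg.regularized_le hl hs hΛ hz' le_rfl hyz
  have h2 : lam ‖z‖ * ‖z - shiftPoint lam c z‖ / Λ = c / (2 * Λ) := by
    rw [norm_sub_rev, e1]; field_simp
  rw [h2] at h1
  have h3 : regularized s Λ B g z ≤
      Real.exp (c / (2 * Λ)) * regularized s Λ B g (shiftPoint lam c z) := by
    refine h1.trans ?_
    gcongr
    linarith [Real.add_one_le_exp (c / (2 * Λ))]
  calc _ ≤ (Real.exp (c / (2 * Λ)) * regularized s Λ B g (shiftPoint lam c z)) ^ a := by gcongr
    _ = _ := by rw [Real.mul_rpow (Real.exp_pos _).le hy0.le, ← Real.exp_mul]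

/-- The weights `(|g|^s + Λ B)^a e^{-pφ}`, `0 ≤ a ≤ N`, satisfy the hypotheses of the
Littlewood–Paley inequality with constants that do not depend on `g`, `B` and `a`: under the radial
shift `e^{-pφ}` decays by a fixed factor, which for large `Λ` is not spoiled by the variation of
`|g|^s + Λ B`. -/
theorem IsSmoothRapidlyDecreasing.exists_isShiftDecaying
    (hφ : IsSmoothRapidlyDecreasing φ) {N : ℝ} (hc1 : c ≤ 1)
    (hl : RadialScale (fun r => 1 + radialDeriv φ r) c K)
    (hlim : ∀ M : ℝ, ∃ r₀ < 1, ∀ r ∈ Ico r₀ 1, M ≤ radialDeriv φ r) (hp : 0 < p) (hs : 0 ≤ s)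
    (hN : 0 ≤ N) :
    ∃ Λ A q r₀ : ℝ, 1 ≤ Λ ∧ 0 < A ∧ 0 < q ∧ q < 1 ∧ c / 2 < r₀ ∧ r₀ < 1 ∧
      ∀ (B : ℝ) (g : ℂ → ℂ), IsBlochSymbol (fun r => 1 + radialDeriv φ r) s B g →
      ∀ a : ℝ, 0 ≤ a → a ≤ N →
      IsShiftDecaying (fun r => 1 + radialDeriv φ r) c A q r₀
        (fun z => regularized s Λ B g z ^ a * Real.exp (-p * φ z)) := by
  obtain ⟨κ, hκ0, hκ⟩ := hφ.exists_shift_drop hc1 hl hlim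
  have hc := hl.c_pos
  have hK : 0 < K := zero_lt_one.trans_le hl.one_le_const
  -- of the factor `exp (-p κ)` gained from `e^{-pφ}`, a third is spent on `|g|^s + Λ B` and a third
  -- on the Jacobian of the shift
  have hq1 : Real.exp (-(p * κ / 3)) < 1 := by
    rw [Real.exp_lt_one_iff]; linarith [show 0 < p * κ / 3 by positivity]
  obtain ⟨r₀, hr₀1, hr₀2, hdrop⟩ := hκ _ hq1
  set Λ := 1 + 3 * N * c / (2 * p * κ) with hΛ
  have hΛ1 : 1 ≤ Λ := by rw [hΛ]; exact le_add_of_nonneg_right (by positivity)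
  have hr₀I : r₀ ∈ Ico (0 : ℝ) 1 := ⟨by linarith, hr₀1⟩
  have hl₀ := hl.pos hr₀I
  have hr₁I := hl.step_mem hr₀I
  have hl₁ := hl.pos hr₁I
  set r₁ := r₀ + c / (1 + radialDeriv φ r₀) with hr₁
  set A₁ := (1 + K * c) ^ N * Real.exp (p * (K * c)) with hA₁
  set A₂ := (1 + (1 + radialDeriv φ r₁) * 2) ^ N *
    Real.exp (p * ((1 + radialDeriv φ r₁) * 2)) with hA₂
  have hA₁0 : 0 < A₁ := by positivity
  have hA₂0 : 0 < A₂ := by positivity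
  refine ⟨Λ, A₁ + A₂, Real.exp (-(p * κ / 3)), r₀, hΛ1, by positivity, Real.exp_pos _, hq1,
    by linarith, hr₀1, fun B g hg a ha haN => ?_⟩
  have hΓ0 : ∀ z, 0 < regularized s Λ B g z := fun z => regularized_pos hg.pos hΛ1 z
  refine ⟨?_, ?_, ?_, ?_, ?_⟩
  · have h1 : ContinuousOn (regularized s Λ B g) disc :=
      (hg.analytic.continuousOn.norm.rpow_const fun _ _ => Or.inr hs).add continuousOn_const
    exact (h1.rpow_const fun _ _ => Or.inr ha).mul
      (Real.continuous_exp.comp_continuousOn (hφ.contDiff.continuousOn.const_smul (-p)))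
  · intro z _
    have := hΓ0 z
    positivity
  · intro z hz w hw
    have hz' := norm_mem_Ico hz
    have hlz := hl.pos hz'
    have hwz : ‖w‖ ≤ ‖z‖ + c / (1 + radialDeriv φ ‖z‖) := by
      have := norm_sub_norm_le w z; linarith
    have hw0 := hΓ0 w
    refine (regularized_weight_le hφ hl hg hp hs hΛ1 ha haN (hl.step_mem hz')
      (le_add_of_nonneg_right (by positivity)) hwz (d := K * c) ?_).trans ?_
    · calc (1 + radialDeriv φ (‖z‖ + c / (1 + radialDeriv φ ‖z‖))) * ‖z - w‖
          ≤ (K * (1 + radialDeriv φ ‖z‖)) * (c / (1 + radialDeriv φ ‖z‖)) := by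
            rw [norm_sub_rev]
            exact mul_le_mul (hl.doubling _ hz') hw.le (norm_nonneg _) (by positivity)
        _ = K * c := by field_simp
    · exact mul_le_mul_of_nonneg_right (le_add_of_nonneg_right hA₂0.le) (by positivity)
  · intro z hz hrz
    obtain ⟨hd1, hd2⟩ := hdrop z hz hrz
    have hcz : c / 2 < ‖z‖ := by linarith
    have hvar := hg.regularized_rpow_le_shift hl hs hΛ1 ha hz hcz
    set y := shiftPoint (fun r => 1 + radialDeriv φ r) c z with hy
    set J := shift (fun r => 1 + radialDeriv φ r) c ‖z‖ / ‖z‖ with hJ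
    have hy0 := hΓ0 y
    have hexp : Real.exp (-p * φ z) ≤ Real.exp (-(p * κ)) * Real.exp (-p * φ y) := by
      rw [← Real.exp_add]
      gcongr
      nlinarith
    have hvar' : Real.exp (c / (2 * Λ) * a) ≤ Real.exp (p * κ / 3) := by
      gcongr
      have h4 : c / (2 * Λ) * a ≤ c / (2 * Λ) * N := by gcongr
      refine h4.trans ?_
      rw [div_mul_eq_mul_div, div_le_iff₀ (by positivity)]
      have h5 : p * κ / 3 * (2 * Λ) = p * κ / 3 * 2 + N * c := by
        rw [hΛ]; field_simp
      rw [h5, mul_comm]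
      exact le_add_of_nonneg_left (by positivity)
    have hjac : 1 ≤ Real.exp (p * κ / 3) * J := by
      calc (1 : ℝ) = Real.exp (p * κ / 3) * Real.exp (-(p * κ / 3)) := by
            rw [← Real.exp_add]; simp
        _ ≤ _ := by gcongr
    have hqe : Real.exp (-(p * κ / 3)) =
        Real.exp (p * κ / 3) * Real.exp (-(p * κ)) * Real.exp (p * κ / 3) := by
      rw [← Real.exp_add, ← Real.exp_add]; congr 1; ring
    calc regularized s Λ B g z ^ a * Real.exp (-p * φ z)
        ≤ (Real.exp (p * κ / 3) * regularized s Λ B g y ^ a) *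
            (Real.exp (-(p * κ)) * Real.exp (-p * φ y)) * 1 := by
          rw [mul_one]
          refine mul_le_mul (hvar.trans ?_) hexp (Real.exp_pos _).le (by positivity)
          gcongr
      _ ≤ (Real.exp (p * κ / 3) * regularized s Λ B g y ^ a) *
            (Real.exp (-(p * κ)) * Real.exp (-p * φ y)) * (Real.exp (p * κ / 3) * J) :=
          mul_le_mul_of_nonneg_left hjac (by positivity)
      _ = _ := by rw [hqe]; ring
  · intro z w hz hw
    have hw0 := hΓ0 w
    have hrr : r₀ ≤ r₁ := le_add_of_nonneg_right (by positivity)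
    refine (regularized_weight_le hφ hl hg hp hs hΛ1 ha haN hr₁I (hz.trans hrr) hw
      (d := (1 + radialDeriv φ r₁) * 2) ?_).trans ?_
    · apply mul_le_mul_of_nonneg_left _ hl₁.le
      have h1 := norm_sub_le z w
      linarith [hr₁I.2, show ‖w‖ ≤ r₁ from hw]
    · exact mul_le_mul_of_nonneg_right (le_add_of_nonneg_left hA₁0.le) (by positivity)

end ShiftDecay

/-! ### Iterated integral operators -/

section Operators

variable {g f H : ℂ → ℂ}

lemma integralFromZero_zero (H : ℂ → ℂ) : integralFromZero H 0 = 0 := by simp [integralFromZero]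

lemma hasDerivAt_integralFromZero (hH : AnalyticOnDisc H) {z : ℂ} (hz : z ∈ disc) :
    HasDerivAt (integralFromZero H) (H z) z := by
  obtain ⟨P, hP⟩ := DifferentiableOn.isExactOn_ball hH
  have key : ∀ w ∈ disc, integralFromZero H w = P w - P 0 := by
    intro w hw
    have hmem : ∀ t ∈ uIcc (0 : ℝ) 1, (t : ℂ) * w ∈ disc := by
      intro t ht
      rw [uIcc_of_le zero_le_one] at ht
      rw [mem_disc, norm_mul, Complex.norm_real, Real.norm_of_nonneg ht.1]
      exact (mul_le_of_le_one_left (norm_nonneg _) ht.2).trans_lt (mem_disc.1 hw)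
    have hline : ∀ t : ℝ, HasDerivAt (fun t : ℝ => (t : ℂ) * w) w t := fun t => by
      refine HasDerivAt.congr_deriv (f := fun t : ℝ => (t : ℂ) * w)
        ((Complex.ofRealCLM.hasDerivAt (x := t)).mul_const w) ?_
      simp
    have h1 := intervalIntegral.integral_eq_sub_of_hasDerivAt (a := 0) (b := 1)
      (f := fun t : ℝ => P ((t : ℂ) * w)) (f' := fun t : ℝ => H ((t : ℂ) * w) * w)
      (fun t ht => (hP _ (hmem t ht)).comp t (hline t))
      (ContinuousOn.intervalIntegrable
        ((hH.continuousOn.comp (by fun_prop) hmem).mul continuousOn_const))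
    simpa [integralFromZero] using h1
  refine ((hP z hz).sub_const (P 0)).congr_of_eventuallyEq ?_
  filter_upwards [isOpen_disc.mem_nhds hz] with w hw using key w hw

lemma AnalyticOnDisc.analytic_integralFromZero (hH : AnalyticOnDisc H) :
    AnalyticOnDisc (integralFromZero H) := fun _ hz =>
  (hasDerivAt_integralFromZero hH hz).differentiableAt.differentiableWithinAt

lemma AnalyticOnDisc.analytic_deriv (hg : AnalyticOnDisc g) : AnalyticOnDisc (deriv g) :=
  DifferentiableOn.deriv hg isOpen_disc

lemma AnalyticOnDisc.hasDerivAt_T (hg : AnalyticOnDisc g) (hf : AnalyticOnDisc f) {z : ℂ}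
    (hz : z ∈ disc) : HasDerivAt (T g f) (f z * deriv g z) z :=
  hasDerivAt_integralFromZero (DifferentiableOn.mul hf hg.analytic_deriv) hz

lemma AnalyticOnDisc.analytic_T (hg : AnalyticOnDisc g) (hf : AnalyticOnDisc f) :
    AnalyticOnDisc (T g f) :=
  AnalyticOnDisc.analytic_integralFromZero (DifferentiableOn.mul hf hg.analytic_deriv)

lemma AnalyticOnDisc.iterate_T (hg : AnalyticOnDisc g) (hf : AnalyticOnDisc f) (k : ℕ) :
    AnalyticOnDisc ((T g)^[k] f) := by
  induction k with
  | zero => exact hf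
  | succ k ih => rw [Function.iterate_succ_apply']; exact hg.analytic_T ih

/-- Since `(S_g F)' = g F'`, iterating `S_g` multiplies the derivative by powers of `g`. -/
lemma AnalyticOnDisc.iterate_S (hg : AnalyticOnDisc g) {F F' : ℂ → ℂ}
    (hF : ∀ z ∈ disc, HasDerivAt F (F' z) z) (h0 : F 0 = 0) (m : ℕ) :
    (∀ z ∈ disc, HasDerivAt ((S g)^[m] F) (F' z * g z ^ m) z) ∧ (S g)^[m] F 0 = 0 := by
  induction m with
  | zero => simpa using ⟨hF, h0⟩
  | succ m ih =>
    rw [Function.iterate_succ_apply']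
    refine ⟨fun z hz => ?_, integralFromZero_zero _⟩
    have han : AnalyticOnDisc ((S g)^[m] F) := fun w hw =>
      (ih.1 w hw).differentiableAt.differentiableWithinAt
    refine HasDerivAt.congr_deriv
      (hasDerivAt_integralFromZero (DifferentiableOn.mul han.analytic_deriv hg) hz) ?_
    rw [Pi.mul_apply, (ih.1 z hz).deriv]
    ring

end Operators

/-! ### The norm estimate -/

section Estimate

variable {φ : ℂ → ℝ}

lemma lintegral_le_of_littlewoodPaley {lam V W : ℂ → ℝ} {p D C₁ : ℝ} {h k F : ℂ → ℂ}
    (hC₁ : 0 ≤ C₁)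
    (hLP : ∫⁻ z in disc, ENNReal.ofReal (‖h z‖ ^ p * V z) ≤
      ENNReal.ofReal C₁ * ∫⁻ z in disc, ENNReal.ofReal ((‖k z‖ / lam z) ^ p * V z))
    (hD : 0 ≤ D)
    (hpt : ∀ z ∈ disc, (‖k z‖ / lam z) ^ p * V z ≤ D * (‖F z‖ ^ p * W z)) :
    ∫⁻ z in disc, ENNReal.ofReal (‖h z‖ ^ p * V z) ≤
      ENNReal.ofReal (C₁ * D) * ∫⁻ z in disc, ENNReal.ofReal (‖F z‖ ^ p * W z) := by
  refine hLP.trans ?_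
  rw [ENNReal.ofReal_mul hC₁, mul_assoc,
    ← lintegral_const_mul' (ENNReal.ofReal D) _ ENNReal.ofReal_ne_top]
  refine mul_le_mul_right ?_ _
  refine setLIntegral_mono' measurableSet_disc fun z hz => ?_
  rw [← ENNReal.ofReal_mul hD]
  exact ENNReal.ofReal_le_ofReal (hpt z hz)

/-- The estimate for `S_g^m T_g^n` in integral form. With `α = m / n` and `Γ` the regularization of
`|g|^s`, the quantities `∫ (Γ^{αk/s} |T_g^k f|)^p e^{-pφ}` are bounded successively for
`k = 0, …, n - 1`. -/
theorem IsSmoothRapidlyDecreasing.exists_lintegral_le (hφ : IsSmoothRapidlyDecreasing φ) {p : ℝ}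
    (hp : 0 < p) (m n : ℕ) (hn : 1 ≤ n) {s : ℝ} (hs : s = (m : ℝ) / (n : ℝ) + 1) :
    ∃ E : ℝ, 0 < E ∧ ∀ (B : ℝ) (g : ℂ → ℂ), IsBlochSymbol (fun r => 1 + radialDeriv φ r) s B g →
      ∀ f : ℂ → ℂ, AnalyticOnDisc f →
      ∫⁻ z in disc, ENNReal.ofReal (‖(S g)^[m] ((T g)^[n] f) z‖ ^ p * Real.exp (-p * φ z)) ≤
        ENNReal.ofReal ((E * B ^ p) ^ n) *
          ∫⁻ z in disc, ENNReal.ofReal (‖f z‖ ^ p * Real.exp (-p * φ z)) := by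
  obtain ⟨c, K, hc1, hl, hlim⟩ := hφ.exists_radialScale
  have hn0 : (0 : ℝ) < n := by exact_mod_cast hn
  have hα : 0 ≤ s - 1 := by rw [hs, add_sub_cancel_right]; positivity
  have hs1 : 1 ≤ s := by linarith
  have hs0 : 0 < s := by linarith
  have hαm : (s - 1) * n = m := by rw [hs, add_sub_cancel_right]; field_simp
  -- the exponents of `Γ` occurring in the weights
  set a : ℕ → ℝ := fun k => (s - 1) / s * k * p with ha
  have ha0 : ∀ k, 0 ≤ a k := fun k => by positivity
  obtain ⟨Λ, A, q, r₀, hΛ, hA, hq0, hq1, hcr, hr₀, hV⟩ :=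
    hφ.exists_isShiftDecaying (s := s) (N := a n) hc1 hl hlim hp hs0.le (ha0 n)
  obtain ⟨C₁, hC₁, hLP⟩ := hl.littlewoodPaley hp hA hq0 hq1 hcr hr₀
  obtain ⟨C₂, hC₂, hder⟩ := exists_regularized_mul_deriv_le hl hs1 hΛ
  refine ⟨C₁ * C₂ ^ p, by positivity, fun B g hg f hf => ?_⟩
  have hB := hg.pos
  have hga := hg.analytic
  have hΓ0 : ∀ z, 0 < regularized s Λ B g z := fun z => regularized_pos hB hΛ z
  set Γ := regularized s Λ B g with hΓ
  set I : ℕ → ℝ≥0∞ := fun k => ∫⁻ z in disc,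
    ENNReal.ofReal (‖(T g)^[k] f z‖ ^ p * (Γ z ^ a k * Real.exp (-p * φ z))) with hI
  have haS : ∀ k, a (k + 1) = (s - 1) / s * p + a k := fun k => by
    simp only [ha]; push_cast; ring
  have hE : C₁ * C₂ ^ p * B ^ p = C₁ * (C₂ * B) ^ p := by
    rw [Real.mul_rpow hC₂.le hB.le]; ring
  have hpow : ∀ z ∈ disc, Γ z ^ ((s - 1) / s * p) * (‖deriv g z‖ / (1 + radialDeriv φ ‖z‖)) ^ p ≤
      (C₂ * B) ^ p := by
    intro z hz
    have hlz := hl.pos (norm_mem_Ico hz)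
    have hz0 := hΓ0 z
    rw [Real.rpow_mul hz0.le, ← Real.mul_rpow (by positivity) (by positivity)]
    refine Real.rpow_le_rpow (by positivity) ?_ hp.le
    rw [← mul_div_assoc, div_le_iff₀ hlz]
    exact hder B g hg z hz
  have hstep : ∀ k, k + 1 ≤ n → I (k + 1) ≤ ENNReal.ofReal (C₁ * C₂ ^ p * B ^ p) * I k := by
    intro k hk
    have hTk := hga.iterate_T hf k
    have hak : a (k + 1) ≤ a n := by
      simp only [ha]; gcongr
    rw [hE]
    refine lintegral_le_of_littlewoodPaley (lam := fun z => 1 + radialDeriv φ ‖z‖)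
      (k := fun z => (T g)^[k] f z * deriv g z) hC₁.le
      (hLP _ (hV B g hg (a (k + 1)) (ha0 _) hak) _ _ ?_ ?_ ?_) (by positivity) ?_
    · intro z hz
      rw [Function.iterate_succ_apply']
      exact hga.hasDerivAt_T hTk hz
    · rw [Function.iterate_succ_apply']
      exact integralFromZero_zero _
    · exact DifferentiableOn.mul hTk hga.analytic_deriv
    · intro z hz
      have hlz := hl.pos (norm_mem_Ico hz)
      have hz0 := hΓ0 z
      rw [norm_mul, mul_div_assoc, Real.mul_rpow (norm_nonneg _) (by positivity), haS,
        Real.rpow_add hz0]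
      calc _ = (Γ z ^ ((s - 1) / s * p) * (‖deriv g z‖ / (1 + radialDeriv φ ‖z‖)) ^ p) *
            (‖(T g)^[k] f z‖ ^ p * (Γ z ^ a k * Real.exp (-p * φ z))) := by ring
        _ ≤ _ := by
          gcongr
          exact hpow z hz
  have hchain : ∀ k, k ≤ n → I k ≤ ENNReal.ofReal (C₁ * C₂ ^ p * B ^ p) ^ k * I 0 := by
    intro k
    induction k with
    | zero => simp
    | succ k ih =>
      intro hk
      calc I (k + 1) ≤ ENNReal.ofReal (C₁ * C₂ ^ p * B ^ p) * I k := hstep k hk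
        _ ≤ ENNReal.ofReal (C₁ * C₂ ^ p * B ^ p) *
            (ENNReal.ofReal (C₁ * C₂ ^ p * B ^ p) ^ k * I 0) := by
          gcongr
          exact ih (by omega)
        _ = _ := by rw [pow_succ']; ring
  obtain ⟨k, rfl⟩ : ∃ k, n = k + 1 := ⟨n - 1, by omega⟩
  have hTk := hga.iterate_T hf k
  have hfirst := hga.iterate_S (F := (T g)^[k + 1] f) (F' := fun z => (T g)^[k] f z * deriv g z)
    (fun z hz => by
      rw [Function.iterate_succ_apply']
      exact hga.hasDerivAt_T hTk hz)
    (by rw [Function.iterate_succ_apply']; exact integralFromZero_zero _) m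
  have hlast : ∫⁻ z in disc,
      ENNReal.ofReal (‖(S g)^[m] ((T g)^[k + 1] f) z‖ ^ p * Real.exp (-p * φ z)) ≤
      ENNReal.ofReal (C₁ * C₂ ^ p * B ^ p) * I k := by
    have hV0 := hV B g hg 0 le_rfl (ha0 _)
    simp only [Real.rpow_zero, one_mul] at hV0
    rw [hE]
    refine lintegral_le_of_littlewoodPaley (lam := fun z => 1 + radialDeriv φ ‖z‖)
      (k := fun z => (T g)^[k] f z * deriv g z * g z ^ m) hC₁.le
      (hLP _ hV0 _ _ hfirst.1 hfirst.2 ?_) (by positivity) ?_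
    · exact DifferentiableOn.mul (DifferentiableOn.mul hTk hga.analytic_deriv)
        (DifferentiableOn.pow hga m)
    · intro z hz
      have hlz := hl.pos (norm_mem_Ico hz)
      have hz0 := hΓ0 z
      have hgm : (‖g z‖ ^ m) ^ p ≤ Γ z ^ a (k + 1) := by
        have h1 : ‖g z‖ ^ s ≤ Γ z := by
          simp only [hΓ, regularized]
          exact le_add_of_nonneg_right (by positivity)
        calc (‖g z‖ ^ m) ^ p = (‖g z‖ ^ s) ^ a (k + 1) := by
              rw [← Real.rpow_natCast, ← Real.rpow_mul (norm_nonneg _),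
                ← Real.rpow_mul (norm_nonneg _), ← hαm]
              congr 1
              simp only [ha]
              field_simp
          _ ≤ _ := by
              have := ha0 (k + 1)
              gcongr
      rw [norm_mul, norm_mul, norm_pow]
      calc (‖(T g)^[k] f z‖ * ‖deriv g z‖ * ‖g z‖ ^ m / (1 + radialDeriv φ ‖z‖)) ^ p *
            Real.exp (-p * φ z)
          = (‖g z‖ ^ m) ^ p * (‖(T g)^[k] f z‖ ^ p *
            (‖deriv g z‖ / (1 + radialDeriv φ ‖z‖)) ^ p) * Real.exp (-p * φ z) := by
            rw [← Real.mul_rpow (by positivity) (by positivity),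
              ← Real.mul_rpow (by positivity) (by positivity)]
            congr 2; ring
        _ ≤ Γ z ^ a (k + 1) * (‖(T g)^[k] f z‖ ^ p *
            (‖deriv g z‖ / (1 + radialDeriv φ ‖z‖)) ^ p) * Real.exp (-p * φ z) := by gcongr
        _ = (Γ z ^ ((s - 1) / s * p) * (‖deriv g z‖ / (1 + radialDeriv φ ‖z‖)) ^ p) *
            (‖(T g)^[k] f z‖ ^ p * (Γ z ^ a k * Real.exp (-p * φ z))) := by
            rw [haS, Real.rpow_add hz0]; ring
        _ ≤ _ := by
          gcongr
          exact hpow z hz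
  have hI0 : I 0 = ∫⁻ z in disc, ENNReal.ofReal (‖f z‖ ^ p * Real.exp (-p * φ z)) := by
    simp [hI, ha]
  rw [← hI0]
  calc _ ≤ ENNReal.ofReal (C₁ * C₂ ^ p * B ^ p) * I k := hlast
    _ ≤ ENNReal.ofReal (C₁ * C₂ ^ p * B ^ p) *
        (ENNReal.ofReal (C₁ * C₂ ^ p * B ^ p) ^ k * I 0) := by
        gcongr
        exact hchain k (by omega)
    _ = _ := by
        rw [ENNReal.ofReal_pow (by positivity), pow_succ']; ring

lemma bergmanNorm_weight (φ : ℂ → ℝ) (p : ℝ) (f : ℂ → ℂ) :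
    bergmanNorm p (fun z => weight φ z ^ (p / 2)) f =
      ((ENNReal.ofReal Real.pi)⁻¹ *
        ∫⁻ z in disc, ENNReal.ofReal (‖f z‖ ^ p * Real.exp (-p * φ z))) ^ (1 / p) := by
  have h : ∀ z, weight φ z ^ (p / 2) = Real.exp (-p * φ z) := fun z => by
    rw [weight, ← Real.exp_mul]; congr 1; ring
  simp only [bergmanNorm, areaMeasure, lintegral_smul_measure, smul_eq_mul, h]

lemma opNorm_le_of_lintegral_le {p E : ℝ} (hp : 0 < p) (hE : 0 ≤ E) {L : (ℂ → ℂ) → (ℂ → ℂ)}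
    (h : ∀ f, AnalyticOnDisc f →
      ∫⁻ z in disc, ENNReal.ofReal (‖L f z‖ ^ p * Real.exp (-p * φ z)) ≤
        ENNReal.ofReal E * ∫⁻ z in disc, ENNReal.ofReal (‖f z‖ ^ p * Real.exp (-p * φ z))) :
    opNorm p (fun z => weight φ z ^ (p / 2)) L ≤ ENNReal.ofReal (E ^ (1 / p)) := by
  refine iSup_le fun f => iSup_le fun hf => iSup_le fun h1 => ?_
  rw [bergmanNorm_weight] at h1 ⊢
  have hp' : 0 ≤ 1 / p := by positivity
  calc _ ≤ ((ENNReal.ofReal Real.pi)⁻¹ * (ENNReal.ofReal E *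
        ∫⁻ z in disc, ENNReal.ofReal (‖f z‖ ^ p * Real.exp (-p * φ z)))) ^ (1 / p) := by
        gcongr
        exact h f hf
    _ = ENNReal.ofReal E ^ (1 / p) := by
        rw [mul_left_comm, ENNReal.mul_rpow_of_nonneg _ _ hp', h1, mul_one]
    _ = _ := ENNReal.ofReal_rpow_of_nonneg hE hp'

end Estimate

end SWBergman

theorem theorem4p1 (φ : ℂ → ℝ) (hφ : SWBergman.IsSmoothRapidlyDecreasing φ)
    (p : ℝ) (hp : 0 < p) (m n : ℕ) (hn : 1 ≤ n) (s : ℝ) (hs : s = (m : ℝ) / (n : ℝ) + 1) :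
    ∃ C : ℝ≥0, 0 < C ∧ ∀ g : ℂ → ℂ, SWBergman.AnalyticOnDisc g →
      SWBergman.opNorm p (fun z => SWBergman.weight φ z ^ (p / 2))
          (fun f => (SWBergman.S g)^[m] ((SWBergman.T g)^[n] f)) ≤
        (C : ℝ≥0∞) * SWBergman.blochNorm φ s g ^ (s * (n : ℝ)) := by
  obtain ⟨E, hE, h⟩ := hφ.exists_lintegral_le hp m n hn hs
  have hs0 : 0 < s := by rw [hs]; positivity
  have hn0 : n ≠ 0 := by omega
  have hC : 0 < (E ^ n) ^ (1 / p) := by positivity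
  refine ⟨((E ^ n) ^ (1 / p)).toNNReal, Real.toNNReal_pos.2 hC, fun g hg => ?_⟩
  set X := ⨆ z ∈ SWBergman.disc, SWBergman.gradNorm (fun w => ‖g w‖ ^ s) z /
    ENNReal.ofReal (1 + SWBergman.radialDeriv φ ‖z‖) with hX
  have hnorm : SWBergman.blochNorm φ s g ^ (s * (n : ℝ)) = X ^ n := by
    rw [SWBergman.blochNorm, ← ENNReal.rpow_mul, ← mul_assoc, one_div_mul_cancel hs0.ne', one_mul,
      ENNReal.rpow_natCast]
  rw [hnorm]
  rcases eq_or_ne X ⊤ with hXt | hXt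
  · rw [hXt, ENNReal.top_pow hn0, ENNReal.mul_top]
    · exact le_top
    · simpa using hC
  -- the estimate holds for every real `B > X`; let `B` decrease to `X`
  have hB : ∀ B : ℝ, X.toReal < B → SWBergman.opNorm p (fun z => SWBergman.weight φ z ^ (p / 2))
      (fun f => (SWBergman.S g)^[m] ((SWBergman.T g)^[n] f)) ≤
      ENNReal.ofReal ((E ^ n) ^ (1 / p) * B ^ n) := by
    intro B hXB
    have hB0 : 0 < B := ENNReal.toReal_nonneg.trans_lt hXB
    have hsym : SWBergman.IsBlochSymbol (fun r => 1 + SWBergman.radialDeriv φ r) s B g := by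
      refine ⟨hg, hB0, fun z hz => ?_⟩
      have hl : 0 < 1 + SWBergman.radialDeriv φ ‖z‖ := by
        have := hφ.radialDeriv_nonneg (SWBergman.norm_mem_Ico hz); linarith
      have h1 : SWBergman.gradNorm (fun w => ‖g w‖ ^ s) z /
          ENNReal.ofReal (1 + SWBergman.radialDeriv φ ‖z‖) ≤ ENNReal.ofReal B := by
        refine (le_iSup₂ (f := fun z (_ : z ∈ SWBergman.disc) =>
          SWBergman.gradNorm (fun w => ‖g w‖ ^ s) z /
            ENNReal.ofReal (1 + SWBergman.radialDeriv φ ‖z‖)) z hz).trans ?_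
        exact (ENNReal.le_ofReal_iff_toReal_le hXt hB0.le).2 hXB.le
      rw [ENNReal.div_le_iff (by simpa using hl) ENNReal.ofReal_ne_top,
        ← ENNReal.ofReal_mul hB0.le] at h1
      exact h1
    refine (SWBergman.opNorm_le_of_lintegral_le (φ := φ) hp (by positivity)
      (h B g hsym)).trans_eq ?_
    congr 1
    rw [mul_pow, Real.mul_rpow (by positivity) (by positivity)]
    congr 1
    rw [← Real.rpow_natCast (B ^ p), ← Real.rpow_mul hB0.le, ← Real.rpow_mul hB0.le,
      ← Real.rpow_natCast]
    congr 1
    field_simp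
  have hlim : Tendsto (fun B : ℝ => ENNReal.ofReal ((E ^ n) ^ (1 / p) * B ^ n)) (𝓝[>] X.toReal)
      (𝓝 (ENNReal.ofReal ((E ^ n) ^ (1 / p) * X.toReal ^ n))) := by
    apply ENNReal.tendsto_ofReal
    exact (((continuous_id.pow n).const_mul _).tendsto _).mono_left nhdsWithin_le_nhds
  have hfin := ge_of_tendsto hlim (by
    filter_upwards [self_mem_nhdsWithin] with B hXB using hB B hXB)
  rwa [ENNReal.ofReal_mul hC.le, ENNReal.ofReal_pow ENNReal.toReal_nonneg,
    ENNReal.ofReal_toReal hXt] at hfin
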